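/- Let $(\Omega,\mathcal F,P)$ be a probability space and let $X,Y\ge 0$ be random variables, possibly dependent, such that the distribution functions $F_X,F_Y,F_{X+Y}$ are continuous. Assume that the tails $\bar F_X=1-F_X$ and $\bar F_Y=1-F_Y$ are positive and regularly varying with indices $-\beta$ and $-\gamma$, where $\beta>1$; that is, $\bar F_X(tx)/\bar F_X(x)\to t^{-\beta}$ and $\bar F_Y(tx)/\bar F_Y(x)\to t^{-\gamma}$ as $x\to\infty$ for every $t>0$. For each $\alpha\in(0,1)$ let $\phi_\alpha:[0,1)\to[0,\infty)$ be right-continuous and non-decreasing with $\int_0^1\phi_\alpha(u)\,du=1$ and $\lim_{u\to1-}\phi_\alpha(u)<\infty$, and assume that the probability measures $\phi_\alpha(u)\,du$ on $[0,1]$ converge weakly to the Dirac measure $\delta_1$ as $\alpha\to1$. Put $\mathrm{VaR}_u(Z)=\inf\{z\in\mathbb R: P(Z\le z)\ge u\}$ and $\rho_\alpha(Z)=\int_0^1\mathrm{VaR}_u(Z)\,\phi_\alpha(u)\,du$, and for $W\in\{X,X+Y\}$ let $Q^W_\alpha$ be the probability measure with $dQ^W_\alpha/dP=\phi_\alpha(F_W(W))$.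 Assume the following. [C5] For every $y\ge0$ the conditional distribution of $X$ given $Y=y$ has a positive, non-increasing density $f_X(\cdot\,|\,Y=y)$ on $[0,\infty)$, and $f_X(x\,|\,Y=y)$ is continuous in $(x,y)\in[0,\infty)^2$. [C6] There is $\kappa\in\mathbb R$ such that, for every $t>0$, $$\sup_{y\ge0}\left|\frac{f_X(tx\,|\,Y=y)}{f_X(x\,|\,Y=y)}-t^\kappa\right|\to0\qquad(x\to\infty).$$ Moreover, $X+Y$ has a density $f_{X+Y}$ that is regularly varying (with some index), that is, ultimately positive with $f_{X+Y}(tx)/f_{X+Y}(x)\to t^{k}$ as $x\to\infty$ for every $t>0$ and some $k\in\mathbb R$. [C7] For some $\eta>\max\{-\kappa-\beta,1\}$, $$\sup_{x\ge0}E[Y^\eta\,|\,X=x]+\sup_{z\ge0}E[Y^\eta\,|\,X+Y=z]<\infty,$$ the suprema being essential suprema with respect to the laws of $X$ and of $X+Y$. Assume also that $\liminf_{\alpha\to1}E^{Q^X_\alpha}[Y]>0$. If $\beta+1<\gamma$, then $$E^{Q^X_\alpha}[Y]\;\sim\;\rho_\alpha(X+Y)-\rho_\alpha(X)\;\sim\;E^{Q^{X+Y}_\alpha}[Y]\qquad(\alpha\to1),$$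 where $a_\alpha\sim b_\alpha$ means $a_\alpha/b_\alpha\to1$. -/

import Mathlib

open MeasureTheory ProbabilityTheory Filter Topology Set

/-- The tail function `x ↦ P(Z > x)`. -/
noncomputable def tailFun {Ω : Type*} [MeasurableSpace Ω] (P : Measure Ω) (Z : Ω → ℝ) (x : ℝ) : ℝ :=
  P.real {ω | x < Z ω}

/-- Value at risk `VaR_u(Z) = inf {z | P(Z ≤ z) ≥ u}`. -/
noncomputable def VaR {Ω : Type*} [MeasurableSpace Ω] (P : Measure Ω) (Z : Ω → ℝ) (u : ℝ) : ℝ :=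
  sInf {z : ℝ | u ≤ cdf (P.map Z) z}

/-- `φ : [0,1) → [0,∞)` is an admissible spectrum: right-continuous, non-decreasing, of integral
one. (Borel measurability on `[0,1)` follows from monotonicity.) -/
structure IsAdmissibleSpectrum (φ : ℝ → ℝ) : Prop where
  nonneg : ∀ u ∈ Ico (0 : ℝ) 1, 0 ≤ φ u
  mono : MonotoneOn φ (Ico 0 1)
  right_cont : ∀ u ∈ Ico (0 : ℝ) 1, ContinuousWithinAt φ (Ici u) u
  integral_eq_one : ∫ u in Ioo (0 : ℝ) 1, φ u = 1

/-- The spectral risk measure `M_φ(Z) = ∫₀¹ VaR_u(Z) φ(u) du`. -/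
noncomputable def spectralRisk {Ω : Type*} [MeasurableSpace Ω] (P : Measure Ω) (φ : ℝ → ℝ)
    (Z : Ω → ℝ) : ℝ :=
  ∫ u in Ioo (0 : ℝ) 1, VaR P Z u * φ u

/-- `(φ_α)`, `0 < α < 1`, is a family of admissible spectra such that the probability measures
`φ_α(u) du` on `[0,1]` converge weakly to the Dirac mass at `1` as `α → 1`. -/
structure IsCLBSpectrum (φ : ℝ → ℝ → ℝ) : Prop where
  admissible : ∀ α ∈ Ioo (0 : ℝ) 1, IsAdmissibleSpectrum (φ α)
  weak_conv : ∀ g : ℝ → ℝ, ContinuousOn g (Icc 0 1) →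
    Tendsto (fun α => ∫ u in Ioo (0 : ℝ) 1, g u * φ α u) (𝓝[<] 1) (𝓝 (g 1))

/-- The measure `Q^W` with `dQ^W/dP = φ(F_W(W))`. -/
noncomputable def spectralMeasure {Ω : Type*} [MeasurableSpace Ω] (P : Measure Ω) (φ : ℝ → ℝ)
    (W : Ω → ℝ) : Measure Ω :=
  P.withDensity fun ω => ENNReal.ofReal (φ (cdf (P.map W) (W ω)))

/-- `f` is (ultimately positive and) regularly varying at infinity with index `k`. -/
def IsRegVarying (f : ℝ → ℝ) (k : ℝ) : Prop :=
  (∀ᶠ x in atTop, 0 < f x) ∧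
    ∀ t : ℝ, 0 < t → Tendsto (fun x => f (t * x) / f x) atTop (𝓝 (t ^ k))

/-- `g` is a density of the real random variable `Z`. -/
structure IsDensityOf {Ω : Type*} [MeasurableSpace Ω] (P : Measure Ω) (Z : Ω → ℝ)
    (g : ℝ → ℝ) : Prop where
  measurable : Measurable g
  nonneg : ∀ z, 0 ≤ g z
  map_eq : P.map Z = volume.withDensity fun z => ENNReal.ofReal (g z)

/-- `f x y` is a regular conditional density `f_X(x | Y = y)` on `[0,∞)` which, for every `y ≥ 0`,
is a positive, non-increasing probability density in `x ≥ 0`, and which is continuous in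
`(x, y)`. -/
structure IsMonotoneCondDensity {Ω : Type*} [MeasurableSpace Ω] (P : Measure Ω) [IsFiniteMeasure P]
    (X Y : Ω → ℝ) (f : ℝ → ℝ → ℝ) : Prop where
  pos : ∀ x, 0 ≤ x → ∀ y, 0 ≤ y → 0 < f x y
  anti : ∀ y, 0 ≤ y → AntitoneOn (fun x => f x y) (Ici 0)
  cont : ContinuousOn (fun p : ℝ × ℝ => f p.1 p.2) (Ici 0 ×ˢ Ici 0)
  total : ∀ y, 0 ≤ y → ∫⁻ x in Ici (0 : ℝ), ENNReal.ofReal (f x y) = 1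
  condDistrib_eq : ∀ᵐ y ∂(P.map Y),
    condDistrib X Y P y = (volume.restrict (Ici 0)).withDensity fun x => ENNReal.ofReal (f x y)

/-- `f(t x | y) / f(x | y) → t ^ κ` as `x → ∞`, uniformly in `y ≥ 0`, for every `t > 0`. -/
def IsUniformlyRegVarying (f : ℝ → ℝ → ℝ) (κ : ℝ) : Prop :=
  ∀ t : ℝ, 0 < t →
    TendstoUniformlyOn (fun x y => f (t * x) y / f x y) (fun _ => t ^ κ) atTop (Ici 0)

/-- `sup_w E[Y ^ η | W = w]` as an extended non-negative number; as conditional expectations given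
`W = w` are determined only up to null sets of the law of `W`, the supremum is the essential one. -/
noncomputable def supCondMoment {Ω : Type*} [MeasurableSpace Ω] (P : Measure Ω) [IsFiniteMeasure P]
    (Y W : Ω → ℝ) (η : ℝ) : ENNReal :=
  essSup (fun w => ∫⁻ y, ENNReal.ofReal (y ^ η) ∂(condDistrib Y W P w)) (P.map W)

/-!
Let `x = VaR_u(X)` and `z = VaR_u(X + Y)` be the quantiles at a common level `u`. All three
quantities of the theorem are averages `∫₀¹ h(u) φ_α(u) du`: the quantile transform
(`map_VaR`, `integral_spectralMeasure`) gives `h(u) = E[Y | X = x]` for `E^{Q^X_α}[Y]` and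
`h(u) = E[Y | X + Y = z]` for `E^{Q^{X+Y}_α}[Y]`, while `h(u) = z - x` for the difference of the
risk measures. These three functions of `u` are essentially bounded and their differences tend to
zero as `u → 1`; since `φ_α(u) du` concentrates at one, the three averages differ by `o(1)`
(`IsCLBSpectrum.tendsto_integral_mul`). The positive lower limit turns this into asymptotic
equivalence.

Write `a(x) = E[f(x | Y)]` for the density of `X` and `b(x) = E[Y f(x | Y)]`, so that
`E[Y | X = x] = b(x) / a(x)`. Two facts drive the comparison. Uniform regular variation and
monotonicity give `f(z - y | y) ≤ (1 + δ) f(z | y)` for all `y ≤ ε z`, uniformly in `y`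
(`extendedDensity_mul_le`); and the conditional moments of order `η > 1` make the event
`Y > ε z` negligible given `X = z` or `X + Y = z` (`weightedMoment_le_setLIntegral_add`).

* Quantile gap (`eventually_gap`). The excess `P(X + Y > z) - P(X > z)` is
  `E[∫_{z - Y}^z f(w | Y) dw]`, which is `b(z) + o(a(z))`; here the part `Y > ε z` is at most
  `P(Y > ε z)`, and this is `o(a(z))` because `z a(z)` dominates a multiple of `P(X > z)` and
  `β + 1 < γ` (`eventually_tailFun_le`). The excess also equals `∫_x^z a`, hence
  `z - x = b(x) / a(x) + o(1)`: first the gap is seen to be bounded, and then `a` and `b` are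
  nearly constant on `[x, z]`.
* Regression functions (`eventually_regression`). The pair `(X + Y, Y)` has joint density
  `f(z - y | y)`, so `X + Y` has density `E[f(z - Y | Y)]` and `E[Y | X + Y = z]` is the quotient
  of `E[Y f(z - Y | Y)]` by it. By the two facts above both are asymptotic to `a` and `b`, up to
  errors that are small compared with the densities (`eventually_shift`).
-/

/-! ### Power bounds for regularly varying tails -/

/-- Climbing the dyadic scale: a one-step bound for `h (2 x) / h x` propagates a property of
`h x * x ^ r` from `[x₀, 2 x₀]` to `[x₀, ∞)`. -/
lemma dyadic_induction {p : ℝ → Prop} {x₀ : ℝ} (hx₀ : 0 < x₀)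
    (hbase : ∀ x ∈ Icc x₀ (2 * x₀), p x) (hstep : ∀ x, x₀ ≤ x → p x → p (2 * x)) :
    ∀ x, x₀ ≤ x → p x := by
  have key : ∀ n : ℕ, ∀ x, x₀ ≤ x → x ≤ 2 ^ n * x₀ → p x := by
    intro n
    induction n with
    | zero => intro x h1 h2; exact hbase x ⟨h1, by simp at h2; linarith⟩
    | succ n ih =>
      intro x h1 h2
      by_cases hx : x ≤ 2 * x₀
      · exact hbase x ⟨h1, hx⟩
      · have h3 := hstep (x / 2) (by linarith)
          (ih (x / 2) (by linarith) (by rw [pow_succ] at h2; linarith))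
        rwa [mul_div_cancel₀ x (two_ne_zero)] at h3
  intro x hx
  obtain ⟨n, hn⟩ := pow_unbounded_of_one_lt (x / x₀) (one_lt_two)
  exact key n x hx ((div_le_iff₀ hx₀).1 hn.le)

/-- Upper Potter bound. For monotone functions the dyadic ratio suffices, with no appeal to the
uniform convergence theorem. -/
lemma IsRegVarying.exists_le_rpow {h : ℝ → ℝ} {b r : ℝ} (hh : IsRegVarying h (-b))
    (hanti : Antitone h) (hr0 : 0 ≤ r) (hr : r < b) :
    ∃ C x₀ : ℝ, 0 < C ∧ 1 ≤ x₀ ∧ ∀ x, x₀ ≤ x → h x ≤ C * x ^ (-r) := by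
  obtain ⟨hpos, hlim⟩ := hh
  have h2 : ∀ᶠ x in atTop, h (2 * x) / h x < (2 : ℝ) ^ (-r) :=
    (hlim 2 two_pos).eventually_lt_const
      (Real.rpow_lt_rpow_of_exponent_lt one_lt_two (by linarith))
  obtain ⟨x₀, hx₀⟩ := eventually_atTop.1 (hpos.and (h2.and (eventually_ge_atTop 1)))
  have h1 : 1 ≤ x₀ := (hx₀ x₀ le_rfl).2.2
  have hp : ∀ x, x₀ ≤ x → h x * x ^ r ≤ h x₀ * (2 * x₀) ^ r := by
    refine dyadic_induction (by linarith) ?_ ?_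
    · rintro x ⟨hx1, hx2⟩
      have := (hx₀ x₀ le_rfl).1
      exact mul_le_mul (hanti hx1) (Real.rpow_le_rpow (by linarith) hx2 hr0)
        (Real.rpow_nonneg (by linarith) _) this.le
    · intro x hx ih
      obtain ⟨hxp, hx2, -⟩ := hx₀ x hx
      rw [div_lt_iff₀ hxp, Real.rpow_neg two_pos.le] at hx2
      have h2r : (0 : ℝ) < 2 ^ r := Real.rpow_pos_of_pos two_pos r
      refine le_trans ?_ ih
      rw [Real.mul_rpow two_pos.le (by linarith)]
      have hxr : 0 ≤ x ^ r := Real.rpow_nonneg (by linarith) _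
      calc h (2 * x) * (2 ^ r * x ^ r) ≤ ((2 ^ r)⁻¹ * h x) * (2 ^ r * x ^ r) := by gcongr
        _ = h x * x ^ r := by field_simp
  refine ⟨h x₀ * (2 * x₀) ^ r, x₀, ?_, h1, fun x hx => ?_⟩
  · have := (hx₀ x₀ le_rfl).1
    have := Real.rpow_pos_of_pos (show 0 < 2 * x₀ by linarith) r
    positivity
  · have hx0 : 0 < x := by linarith
    rw [Real.rpow_neg hx0.le, ← div_eq_mul_inv, le_div_iff₀ (Real.rpow_pos_of_pos hx0 r)]
    exact hp x hx

/-- Lower Potter bound. -/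
lemma IsRegVarying.exists_rpow_le {h : ℝ → ℝ} {b r : ℝ} (hh : IsRegVarying h (-b))
    (hanti : Antitone h) (hr0 : 0 ≤ r) (hr : b < r) :
    ∃ c x₀ : ℝ, 0 < c ∧ 1 ≤ x₀ ∧ ∀ x, x₀ ≤ x → c * x ^ (-r) ≤ h x := by
  obtain ⟨hpos, hlim⟩ := hh
  have h2 : ∀ᶠ x in atTop, (2 : ℝ) ^ (-r) < h (2 * x) / h x :=
    (hlim 2 two_pos).eventually_const_lt
      (Real.rpow_lt_rpow_of_exponent_lt one_lt_two (by linarith))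
  obtain ⟨x₀, hx₀⟩ := eventually_atTop.1 (hpos.and (h2.and (eventually_ge_atTop 1)))
  have h1 : 1 ≤ x₀ := (hx₀ x₀ le_rfl).2.2
  have hp : ∀ x, x₀ ≤ x → h (2 * x₀) * x₀ ^ r ≤ h x * x ^ r := by
    refine dyadic_induction (by linarith) ?_ ?_
    · rintro x ⟨hx1, hx2⟩
      exact mul_le_mul (hanti hx2) (Real.rpow_le_rpow (by linarith) hx1 hr0)
        (Real.rpow_nonneg (by linarith) _) (hx₀ x hx1).1.le
    · intro x hx ih
      obtain ⟨hxp, hx2, -⟩ := hx₀ x hx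
      rw [lt_div_iff₀ hxp, Real.rpow_neg two_pos.le] at hx2
      have h2r : (0 : ℝ) < 2 ^ r := Real.rpow_pos_of_pos two_pos r
      refine ih.trans ?_
      rw [Real.mul_rpow two_pos.le (by linarith)]
      have hxr : 0 ≤ x ^ r := Real.rpow_nonneg (by linarith) _
      calc h x * x ^ r = ((2 ^ r)⁻¹ * h x) * (2 ^ r * x ^ r) := by field_simp
        _ ≤ h (2 * x) * (2 ^ r * x ^ r) := by gcongr
  refine ⟨h (2 * x₀) * x₀ ^ r, x₀, ?_, h1, fun x hx => ?_⟩
  · have := (hx₀ (2 * x₀) (by linarith)).1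
    have := Real.rpow_pos_of_pos (show 0 < x₀ by linarith) r
    positivity
  · have hx0 : 0 < x := by linarith
    rw [Real.rpow_neg hx0.le, ← div_eq_mul_inv, div_le_iff₀ (Real.rpow_pos_of_pos hx0 r)]
    exact hp x hx

section
variable {Ω : Type*} [MeasurableSpace Ω] {P : Measure Ω}

variable [IsProbabilityMeasure P]

lemma antitone_tailFun (Z : Ω → ℝ) : Antitone (tailFun P Z) := fun _ _ h =>
  measureReal_mono fun _ hω => lt_of_le_of_lt h hω

lemma tailFun_pos {Z : Ω → ℝ} {b : ℝ} (hZ : IsRegVarying (tailFun P Z) b) (x : ℝ) :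
    0 < tailFun P Z x := by
  obtain ⟨y, hy, hxy⟩ := (hZ.1.and (eventually_ge_atTop x)).exists
  exact hy.trans_le (antitone_tailFun Z hxy)

lemma integrable_of_isRegVarying_tailFun {X : Ω → ℝ} (hX : Measurable X) (hX0 : ∀ ω, 0 ≤ X ω)
    {β : ℝ} (hβ : 1 < β) (hXtail : IsRegVarying (tailFun P X) (-β)) : Integrable X P := by
  obtain ⟨r, hr1, hr⟩ := exists_between hβ
  obtain ⟨C, x₀, hC, hx₀, hb⟩ :=
    hXtail.exists_le_rpow (antitone_tailFun X) (by linarith) hr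
  refine ⟨hX.aestronglyMeasurable, ?_⟩
  rw [hasFiniteIntegral_iff_ofReal (ae_of_all _ hX0),
    lintegral_eq_lintegral_meas_lt P (ae_of_all _ hX0) hX.aemeasurable]
  have hsplit : Ioi (0 : ℝ) ⊆ Ioc 0 x₀ ∪ Ioi x₀ := by
    intro x hx
    rcases le_or_gt x x₀ with h | h
    · exact Or.inl ⟨hx, h⟩
    · exact Or.inr h
  refine ((lintegral_mono_set hsplit).trans (lintegral_union_le _ _ _)).trans_lt ?_
  refine ENNReal.add_lt_top.2 ⟨?_, ?_⟩
  · calc ∫⁻ t in Ioc 0 x₀, P {a | t < X a} ≤ ∫⁻ _ in Ioc 0 x₀, 1 :=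
        lintegral_mono fun _ => prob_le_one
      _ < ⊤ := by simp
  · calc ∫⁻ t in Ioi x₀, P {a | t < X a} ≤ ∫⁻ t in Ioi x₀, ENNReal.ofReal (C * t ^ (-r)) := by
          refine setLIntegral_mono' measurableSet_Ioi fun t ht => ?_
          rw [← ofReal_measureReal (measure_ne_top _ _)]
          exact ENNReal.ofReal_le_ofReal (hb t (le_of_lt ht))
      _ < ⊤ := ((integrableOn_Ioi_rpow_of_lt (by linarith) (by linarith)).const_mul
          C).lintegral_lt_top

end

/-! ### Quantiles -/

section
variable {Ω : Type*} [MeasurableSpace Ω] {P : Measure Ω}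

/-- The Galois connection between the value at risk and the distribution function. -/
lemma VaR_le_iff (Z : Ω → ℝ) {u : ℝ} (hu : u ∈ Ioo (0 : ℝ) 1) (z : ℝ) :
    VaR P Z u ≤ z ↔ u ≤ cdf (P.map Z) z := by
  have hbot := (tendsto_cdf_atBot (P.map Z)).eventually_lt_const hu.1
  have htop := (tendsto_cdf_atTop (P.map Z)).eventually_const_lt hu.2
  obtain ⟨a, ha⟩ := hbot.exists
  obtain ⟨b, hb⟩ := htop.exists
  have hbdd : BddBelow {z : ℝ | u ≤ cdf (P.map Z) z} := by
    refine ⟨a, fun z hz => ?_⟩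
    by_contra! h
    exact absurd (monotone_cdf (P.map Z) h.le) (not_le.2 (ha.trans_le hz))
  refine ⟨fun h => ?_, fun h => csInf_le hbdd h⟩
  have hgt : ∀ w, z < w → u ≤ cdf (P.map Z) w := by
    intro w hw
    obtain ⟨v, hv, hvw⟩ := (csInf_lt_iff hbdd ⟨b, hb.le⟩).1 (lt_of_le_of_lt h hw)
    exact le_trans hv (monotone_cdf _ hvw.le)
  have hc := ((cdf (P.map Z)).right_continuous z).mono (Ioi_subset_Ici_self)
  exact ge_of_tendsto hc (eventually_mem_nhdsWithin.mono fun w hw => hgt w hw)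

lemma lt_VaR_iff (Z : Ω → ℝ) {u : ℝ} (hu : u ∈ Ioo (0 : ℝ) 1) (z : ℝ) :
    z < VaR P Z u ↔ cdf (P.map Z) z < u := by
  rw [← not_le, VaR_le_iff Z hu, not_le]

lemma cdf_VaR {Z : Ω → ℝ} (hF : Continuous fun z => cdf (P.map Z) z) {u : ℝ}
    (hu : u ∈ Ioo (0 : ℝ) 1) : cdf (P.map Z) (VaR P Z u) = u := by
  refine le_antisymm ?_ ((VaR_le_iff Z hu _).1 le_rfl)
  have hc : Tendsto (fun z => cdf (P.map Z) z) (𝓝[<] (VaR P Z u)) (𝓝 _) :=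
    (hF.tendsto (VaR P Z u)).mono_left nhdsWithin_le_nhds
  exact le_of_tendsto hc (eventually_mem_nhdsWithin.mono fun w hw => ((lt_VaR_iff Z hu w).1 hw).le)

lemma monotoneOn_VaR (Z : Ω → ℝ) : MonotoneOn (VaR P Z) (Ioo 0 1) := fun _ hu _ hv huv =>
  (VaR_le_iff Z hu _).2 (huv.trans ((VaR_le_iff Z hv _).1 le_rfl))

lemma aemeasurable_VaR (Z : Ω → ℝ) : AEMeasurable (VaR P Z) (volume.restrict (Ioo 0 1)) :=
  aemeasurable_restrict_of_monotoneOn measurableSet_Ioo (monotoneOn_VaR Z)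

lemma tendsto_VaR_atTop {Z : Ω → ℝ} (hF1 : ∀ z, cdf (P.map Z) z < 1) :
    Tendsto (VaR P Z) (𝓝[<] 1) atTop := by
  refine tendsto_atTop.2 fun K => ?_
  have h : max 0 (cdf (P.map Z) K) < 1 := max_lt one_pos (hF1 K)
  filter_upwards [Ioo_mem_nhdsLT h] with u hu
  have hu' := max_lt_iff.1 hu.1
  exact ((lt_VaR_iff Z ⟨hu'.1, hu.2⟩ K).2 hu'.2).le

variable [IsProbabilityMeasure P]

lemma cdf_map_eq {Z : Ω → ℝ} (hZ : Measurable Z) (z : ℝ) :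
    cdf (P.map Z) z = P.real {ω | Z ω ≤ z} := by
  have := Measure.isProbabilityMeasure_map (μ := P) hZ.aemeasurable
  rw [cdf_eq_real, map_measureReal_apply hZ measurableSet_Iic]
  rfl

lemma tailFun_eq_one_sub {Z : Ω → ℝ} (hZ : Measurable Z) (z : ℝ) :
    tailFun P Z z = 1 - cdf (P.map Z) z := by
  have h := probReal_compl_eq_one_sub (μ := P) (hZ measurableSet_Iic : MeasurableSet (Z ⁻¹' Iic z))
  rw [cdf_map_eq hZ, tailFun]
  have h2 : {ω | z < Z ω} = (Z ⁻¹' Iic z)ᶜ := by ext ω; simp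
  rw [h2, h]
  rfl

/-- The quantile transform: the value at risk at a uniform level has the law of `Z`. -/
lemma map_VaR {Z : Ω → ℝ} (hZ : Measurable Z) :
    (volume.restrict (Ioo (0 : ℝ) 1)).map (VaR P Z) = P.map Z := by
  have := Measure.isProbabilityMeasure_map (μ := P) hZ.aemeasurable
  refine (Measure.ext_of_Iic _ _ fun z => ?_).symm
  rw [Measure.map_apply_of_aemeasurable (aemeasurable_VaR Z) measurableSet_Iic, ← ofReal_cdf,
    Measure.restrict_apply₀' measurableSet_Ioo.nullMeasurableSet]
  have h0 := cdf_nonneg (P.map Z) z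
  have h1 := cdf_le_one (P.map Z) z
  have hset : (VaR P Z ⁻¹' Iic z ∩ Ioo 0 1 : Set ℝ) =ᵐ[volume] Ioc 0 (cdf (P.map Z) z) := by
    have : ∀ᵐ u : ℝ, u ≠ 1 := by simp [ae_iff]
    filter_upwards [this] with u hu1
    apply propext
    change (VaR P Z u ≤ z ∧ u ∈ Ioo 0 1) ↔ (0 < u ∧ u ≤ cdf (P.map Z) z)
    constructor
    · rintro ⟨h, hu⟩
      exact ⟨hu.1, (VaR_le_iff Z hu z).1 h⟩
    · rintro ⟨hu, h⟩
      have hu' : u ∈ Ioo (0 : ℝ) 1 := ⟨hu, lt_of_le_of_ne (h.trans h1) hu1⟩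
      exact ⟨(VaR_le_iff Z hu' z).2 h, hu'⟩
  rw [measure_congr hset]
  simp

lemma VaR_le_VaR {X Z : Ω → ℝ} (hX : Measurable X) (hZ : Measurable Z) (hXZ : ∀ ω, X ω ≤ Z ω)
    {u : ℝ} (hu : u ∈ Ioo (0 : ℝ) 1) : VaR P X u ≤ VaR P Z u := by
  rw [VaR_le_iff X hu]
  refine ((VaR_le_iff Z hu _).1 (le_refl (VaR P Z u))).trans ?_
  rw [cdf_map_eq hX, cdf_map_eq hZ]
  exact measureReal_mono fun ω hω => (hXZ ω).trans hω

lemma VaR_nonneg {Z : Ω → ℝ} (hZ : Measurable Z) (hZ0 : ∀ ω, 0 ≤ Z ω)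
    {u : ℝ} (hu : u ∈ Ioo (0 : ℝ) 1) : 0 ≤ VaR P Z u := by
  by_contra! h
  have h1 := (VaR_le_iff Z hu _).1 (le_refl (VaR P Z u))
  have h2 : cdf (P.map Z) (VaR P Z u) = 0 := by
    rw [cdf_map_eq hZ]
    have : {ω | Z ω ≤ VaR P Z u} = ∅ := by
      ext ω; simpa using h.trans_le (hZ0 ω)
    simp [this]
  linarith [hu.1]

lemma integrableOn_VaR {Z : Ω → ℝ} (hZ : Measurable Z) (hint : Integrable Z P) :
    IntegrableOn (VaR P Z) (Ioo 0 1) := by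
  have h : Integrable id (P.map Z) := (integrable_map_measure
    measurable_id.aestronglyMeasurable hZ.aemeasurable).2 hint
  rw [← map_VaR hZ] at h
  exact (integrable_map_measure measurable_id.aestronglyMeasurable (aemeasurable_VaR Z)).1 h

end

/-! ### Admissible spectra -/

lemma IsAdmissibleSpectrum.integrableOn {φ : ℝ → ℝ} (hφ : IsAdmissibleSpectrum φ) :
    IntegrableOn φ (Ioo 0 1) := by
  by_contra h
  have := hφ.integral_eq_one
  rw [integral_undef h] at this
  exact zero_ne_one this

lemma IsAdmissibleSpectrum.measurable_indicator {φ : ℝ → ℝ} (hφ : IsAdmissibleSpectrum φ) :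
    Measurable ((Ico (0 : ℝ) 1).indicator φ) := by
  refine measurable_of_restrict_of_restrict_compl (s := Ico (0 : ℝ) 1) measurableSet_Ico ?_ ?_
  · have : Monotone ((Ico (0 : ℝ) 1).domRestrict φ) := fun a b hab => hφ.mono a.2 b.2 hab
    convert this.measurable using 1
    exact funext fun a => indicator_of_mem a.2 φ
  · convert measurable_const (a := (0 : ℝ)) using 1
    exact funext fun a => indicator_of_notMem a.2 φ

lemma IsAdmissibleSpectrum.le_of_tendsto {φ : ℝ → ℝ} (hφ : IsAdmissibleSpectrum φ) {L : ℝ}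
    (hL : Tendsto φ (𝓝[<] 1) (𝓝 L)) {u : ℝ} (hu : u ∈ Ico (0 : ℝ) 1) : φ u ≤ L := by
  refine ge_of_tendsto hL ?_
  filter_upwards [Ioo_mem_nhdsLT hu.2] with v hv
  exact hφ.mono hu ⟨hu.1.trans hv.1.le, hv.2⟩ hv.1.le

lemma IsAdmissibleSpectrum.abs_indicator_le {φ : ℝ → ℝ} (hφ : IsAdmissibleSpectrum φ) {L : ℝ}
    (hL : Tendsto φ (𝓝[<] 1) (𝓝 L)) (u : ℝ) : |(Ico (0 : ℝ) 1).indicator φ u| ≤ L := by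
  have hL0 : 0 ≤ L := (hφ.nonneg 0 (by simp)).trans (hφ.le_of_tendsto hL (by simp))
  by_cases hu : u ∈ Ico (0 : ℝ) 1
  · rw [indicator_of_mem hu, abs_of_nonneg (hφ.nonneg u hu)]
    exact hφ.le_of_tendsto hL hu
  · rw [indicator_of_notMem hu, abs_zero]
    exact hL0

/-- Spectra concentrating at level one do not see an essentially bounded function that vanishes
there. -/
lemma IsCLBSpectrum.tendsto_integral_mul {φ : ℝ → ℝ → ℝ} (hφ : IsCLBSpectrum φ) {h : ℝ → ℝ}
    {K : ℝ} (hK : ∀ᵐ u ∂(volume.restrict (Ioo (0 : ℝ) 1)), |h u| ≤ K)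
    (hlim : ∀ δ : ℝ, 0 < δ → ∃ u₀ < (1 : ℝ),
      ∀ᵐ u ∂(volume.restrict (Ioo (0 : ℝ) 1)), u₀ < u → |h u| ≤ δ) :
    Tendsto (fun α => ∫ u in Ioo (0 : ℝ) 1, h u * φ α u) (𝓝[<] 1) (𝓝 0) := by
  rw [Metric.tendsto_nhds]
  intro ε hε
  obtain ⟨u₀, hu₀, hδ⟩ := hlim (ε / 2) (half_pos hε)
  -- a continuous majorant of `|h|` with value `ε / 2` at one
  set g : ℝ → ℝ := fun u => ε / 2 + |K| * min 1 ((1 - u) / (1 - u₀)) with hg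
  have hgc : Continuous g := by fun_prop
  have hg1 : g 1 < ε := by simp [hg]; linarith
  have hgb : ∀ᵐ u ∂(volume.restrict (Ioo (0 : ℝ) 1)), |h u| ≤ g u := by
    filter_upwards [hK, hδ, ae_restrict_mem measurableSet_Ioo] with u h1 h2 hu
    rcases lt_or_ge u₀ u with h | h
    · have h3 : 0 ≤ min 1 ((1 - u) / (1 - u₀)) :=
        le_min zero_le_one (div_nonneg (by linarith [hu.2]) (by linarith))
      exact (h2 h).trans (le_add_of_nonneg_right (mul_nonneg (abs_nonneg K) h3))
    · have h3 : min 1 ((1 - u) / (1 - u₀)) = 1 :=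
        min_eq_left ((one_le_div (by linarith)).2 (by linarith))
      have := le_abs_self K
      simp only [hg, h3]
      linarith
  have hev := (hφ.weak_conv g hgc.continuousOn).eventually_lt_const hg1
  filter_upwards [hev, Ioo_mem_nhdsLT (zero_lt_one (α := ℝ))] with α hα hα01
  have hadm := hφ.admissible α hα01
  rw [dist_zero_right]
  refine (norm_integral_le_of_norm_le (g := fun u => g u * φ α u) ?_ ?_).trans_lt hα
  · have hb : ∀ᵐ u ∂(volume.restrict (Ioo (0 : ℝ) 1)), ‖g u‖ ≤ ε / 2 + |K| := by
      filter_upwards [ae_restrict_mem measurableSet_Ioo] with u hu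
      have h3 : 0 ≤ min 1 ((1 - u) / (1 - u₀)) :=
        le_min zero_le_one (div_nonneg (by linarith [hu.2]) (by linarith))
      have h4 : min 1 ((1 - u) / (1 - u₀)) ≤ 1 := min_le_left _ _
      have h5 : 0 ≤ g u := add_nonneg (half_pos hε).le (mul_nonneg (abs_nonneg K) h3)
      rw [Real.norm_of_nonneg h5]
      have := mul_le_mul_of_nonneg_left h4 (abs_nonneg K)
      simp only [hg]
      linarith
    exact hadm.integrableOn.bdd_mul hgc.aestronglyMeasurable hb
  · filter_upwards [hgb, ae_restrict_mem measurableSet_Ioo] with u h1 hu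
    have h0 := hadm.nonneg u ⟨hu.1.le, hu.2⟩
    rw [norm_mul, Real.norm_eq_abs, Real.norm_of_nonneg h0]
    exact mul_le_mul_of_nonneg_right h1 h0

section
variable {Ω : Type*} [MeasurableSpace Ω] {P : Measure Ω} [IsProbabilityMeasure P]

/-- The expectation under `Q^W` as a spectral average of the regression function `E[Y | W = w]`
at the quantiles of `W`. -/
lemma integral_spectralMeasure {Y W : Ω → ℝ} (hY : Integrable Y P) (hYm : Measurable Y)
    (hW : Measurable W) (hF : Continuous fun w => cdf (P.map W) w)
    (hF1 : ∀ w, cdf (P.map W) w < 1) {φ : ℝ → ℝ} (hφ : IsAdmissibleSpectrum φ) {L : ℝ}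
    (hL : Tendsto φ (𝓝[<] 1) (𝓝 L)) :
    ∫ ω, Y ω ∂(spectralMeasure P φ W) =
      ∫ u in Ioo (0 : ℝ) 1, (∫ y, y ∂(condDistrib Y W P (VaR P W u))) * φ u := by
  set F : ℝ → ℝ := fun w => cdf (P.map W) w with hFdef
  -- `φ` is arbitrary off `[0, 1)`; its truncation `ψ` is measurable and agrees with it on the
  -- range of `F`
  set ψ := (Ico (0 : ℝ) 1).indicator φ with hψdef
  have hψ : Measurable ψ := hφ.measurable_indicator
  have hψF : ∀ w, φ (F w) = ψ (F w) := fun w =>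
    (indicator_of_mem (show F w ∈ Ico (0 : ℝ) 1 from ⟨cdf_nonneg _ _, hF1 w⟩) φ).symm
  have hψ0 : ∀ w, 0 ≤ ψ w := fun w => indicator_nonneg hφ.nonneg w
  have hmeas : Measurable fun w => ψ (F w) := hψ.comp hF.measurable
  have hprob := Measure.isProbabilityMeasure_map (μ := P) hW.aemeasurable
  have hint : Integrable (fun p : ℝ × ℝ => ψ (F p.1) * p.2) (P.map fun ω => (W ω, Y ω)) := by
    refine (integrable_map_measure ?_ (hW.prodMk hYm).aemeasurable).2 ?_
    · exact ((hmeas.comp measurable_fst).mul measurable_snd).aestronglyMeasurable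
    · exact hY.bdd_mul (c := L) (hmeas.comp hW).aestronglyMeasurable
        (ae_of_all _ fun ω => hφ.abs_indicator_le hL _)
  have hk : StronglyMeasurable fun w => ∫ y, y ∂(condDistrib Y W P w) :=
    (measurable_snd.stronglyMeasurable (f := fun p : ℝ × ℝ => p.2)).integral_condDistrib
  calc ∫ ω, Y ω ∂(spectralMeasure P φ W)
      = ∫ ω, ψ (F (W ω)) * Y ω ∂P := by
        unfold spectralMeasure
        simp_rw [← hFdef]
        rw [show (fun ω => ENNReal.ofReal (φ (cdf (P.map W) (W ω)))) =
          fun ω => ENNReal.ofReal (ψ (F (W ω))) from funext fun ω => by rw [← hψF]]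
        rw [integral_withDensity_eq_integral_toReal_smul₀
          (f := fun ω => ENNReal.ofReal (ψ (F (W ω))))
          (hmeas.comp hW).ennreal_ofReal.aemeasurable (ae_of_all _ fun _ => ENNReal.ofReal_lt_top)]
        simp only [ENNReal.toReal_ofReal (hψ0 _), smul_eq_mul]
    _ = ∫ p, ψ (F p.1) * p.2 ∂(P.map fun ω => (W ω, Y ω)) := by
        exact (integral_map (f := fun p : ℝ × ℝ => ψ (F p.1) * p.2)
          (hW.prodMk hYm).aemeasurable
          ((hmeas.comp measurable_fst).mul measurable_snd).aestronglyMeasurable).symm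
    _ = ∫ w, ψ (F w) * ∫ y, y ∂(condDistrib Y W P w) ∂(P.map W) := by
        rw [← compProd_map_condDistrib hYm.aemeasurable] at hint ⊢
        rw [Measure.integral_compProd hint]
        exact integral_congr_ae (ae_of_all _ fun w => integral_const_mul (ψ (F w)) fun y => y)
    _ = ∫ u in Ioo (0 : ℝ) 1, ψ (F (VaR P W u)) * ∫ y, y ∂(condDistrib Y W P (VaR P W u)) := by
        rw [← map_VaR hW]
        refine integral_map (aemeasurable_VaR W) ?_
        exact (hmeas.mul hk.measurable).aestronglyMeasurable
    _ = _ := by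
        refine setIntegral_congr_fun measurableSet_Ioo fun u hu => ?_
        simp only [← hψF]
        rw [show F (VaR P W u) = u from cdf_VaR hF hu, mul_comm]

end

/-! ### Joint densities with respect to Lebesgue measure times the law of `Y` -/

section
variable {Ω : Type*} [MeasurableSpace Ω]

/-- `q` is the density of the pair `(W, Y)` with respect to the product of Lebesgue measure and
the law of `Y`, i.e. `q · y` is a conditional density of `W` given `Y = y`. -/
structure IsJointDensity (P : Measure Ω) (W Y : Ω → ℝ) (q : ℝ → ℝ → ENNReal) : Prop where
  measurable : Measurable (Function.uncurry q)
  lintegral_eq : ∀ H : ℝ × ℝ → ENNReal, Measurable H →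
    ∫⁻ ω, H (W ω, Y ω) ∂P = ∫⁻ y, (∫⁻ w, H (w, y) * q w y) ∂(P.map Y)

variable {P : Measure Ω} {W Y : Ω → ℝ} {q : ℝ → ℝ → ENNReal}

lemma ae_map_nonneg (hY : Measurable Y) (hY0 : ∀ ω, 0 ≤ Y ω) : ∀ᵐ y ∂(P.map Y), 0 ≤ y :=
  (ae_map_iff hY.aemeasurable measurableSet_Ici).2 (ae_of_all _ hY0)

lemma IsJointDensity.add {X : Ω → ℝ}
    (hq : IsJointDensity P X Y q) :
    IsJointDensity P (X + Y) Y fun z y => q (z - y) y where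
  measurable := hq.measurable.comp ((measurable_fst.sub measurable_snd).prodMk measurable_snd)
  lintegral_eq H hH := by
    have h := hq.lintegral_eq (fun p => H (p.1 + p.2, p.2))
      (hH.comp ((measurable_fst.add measurable_snd).prodMk measurable_snd))
    simp only [Pi.add_apply]
    rw [h]
    refine lintegral_congr fun y => ?_
    rw [← lintegral_sub_right_eq_self (μ := volume) (fun w => H (w + y, y) * q w y) y]
    simp

variable [IsProbabilityMeasure P]

lemma measurable_lintegral_mul (hq : Measurable (Function.uncurry q)) {c : ℝ → ENNReal}
    (hc : Measurable c) : Measurable fun w => ∫⁻ y, c y * q w y ∂(P.map Y) :=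
  Measurable.lintegral_prod_right' (f := fun p : ℝ × ℝ => c p.2 * q p.1 p.2)
    ((hc.comp measurable_snd).mul hq)

lemma IsJointDensity.lintegral_mul (hq : IsJointDensity P W Y q) {b c : ℝ → ENNReal}
    (hb : Measurable b) (hc : Measurable c) :
    ∫⁻ ω, b (W ω) * c (Y ω) ∂P = ∫⁻ w, b w * ∫⁻ y, c y * q w y ∂(P.map Y) := by
  have hH : Measurable fun p : ℝ × ℝ => b p.1 * c p.2 :=
    (hb.comp measurable_fst).mul (hc.comp measurable_snd)
  rw [hq.lintegral_eq (fun p => b p.1 * c p.2) hH, lintegral_lintegral_swap]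
  · refine lintegral_congr fun w => ?_
    have hm : Measurable fun y => c y * q w y := hc.mul (hq.measurable.comp measurable_prodMk_left)
    simp only [← lintegral_const_mul _ hm, mul_assoc]
  · exact ((hH.mul hq.measurable).comp measurable_swap).aemeasurable

lemma IsJointDensity.map_eq (hq : IsJointDensity P W Y q) (hW : Measurable W) :
    P.map W = volume.withDensity fun w => ∫⁻ y, q w y ∂(P.map Y) := by
  ext B hB
  have h := hq.lintegral_mul (b := B.indicator 1) (c := fun _ => 1)
    (measurable_one.indicator hB) measurable_const
  simp only [mul_one, one_mul] at h
  rw [withDensity_apply _ hB, ← lintegral_indicator hB, ← lintegral_indicator_one hB,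
    lintegral_map (measurable_one.indicator hB) hW, h]
  refine lintegral_congr fun w => ?_
  by_cases hw : w ∈ B <;> simp [hw]

lemma IsJointDensity.measurable_marginal (hq : IsJointDensity P W Y q) :
    Measurable fun w => ∫⁻ y, q w y ∂(P.map Y) := by
  simpa using measurable_lintegral_mul (P := P) (Y := Y) hq.measurable (measurable_one)

lemma IsJointDensity.ae_map_iff (hq : IsJointDensity P W Y q) (hW : Measurable W)
    {p : ℝ → Prop} :
    (∀ᵐ w ∂(P.map W), p w) ↔ ∀ᵐ w, ∫⁻ y, q w y ∂(P.map Y) ≠ 0 → p w := by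
  rw [hq.map_eq hW, ae_withDensity_iff hq.measurable_marginal]

lemma IsJointDensity.marginal_lt_top (hq : IsJointDensity P W Y q) :
    ∀ᵐ w, ∫⁻ y, q w y ∂(P.map Y) < ⊤ := by
  refine ae_lt_top hq.measurable_marginal ?_
  have h := hq.lintegral_mul (b := fun _ => 1) (c := fun _ => 1) measurable_const measurable_const
  simp only [mul_one, one_mul, lintegral_const, measure_univ] at h
  rw [← h]
  exact ENNReal.one_ne_top

/-- Bayes' formula for conditional expectations given `W` in terms of the joint density. -/
lemma IsJointDensity.lintegral_condDistrib (hq : IsJointDensity P W Y q) (hW : Measurable W)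
    (hY : Measurable Y) {c : ℝ → ENNReal} (hc : Measurable c) :
    ∀ᵐ w, ∫⁻ y, c y * q w y ∂(P.map Y) =
      (∫⁻ y, c y ∂(condDistrib Y W P w)) * ∫⁻ y, q w y ∂(P.map Y) := by
  have hk : Measurable fun w => ∫⁻ y, c y ∂(condDistrib Y W P w) := hc.lintegral_kernel
  refine ae_eq_of_forall_setLIntegral_eq_of_sigmaFinite
    (measurable_lintegral_mul hq.measurable hc) (hk.mul hq.measurable_marginal) fun B hB _ => ?_
  have hb : Measurable (B.indicator (1 : ℝ → ENNReal)) := measurable_one.indicator hB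
  have h1 := hq.lintegral_mul (b := B.indicator 1) (c := c) hb hc
  have h2 := hq.lintegral_mul (b := fun w => B.indicator 1 w * ∫⁻ y, c y ∂(condDistrib Y W P w))
    (c := fun _ => 1) (hb.mul hk) measurable_const
  have h3 : ∫⁻ ω, B.indicator 1 (W ω) * c (Y ω) ∂P =
      ∫⁻ ω, B.indicator 1 (W ω) * ∫⁻ y, c y ∂(condDistrib Y W P (W ω)) ∂P := by
    have hH : Measurable fun p : ℝ × ℝ => B.indicator (1 : ℝ → ENNReal) p.1 * c p.2 :=
      (hb.comp measurable_fst).mul (hc.comp measurable_snd)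
    rw [← lintegral_map (f := fun p : ℝ × ℝ => B.indicator (1 : ℝ → ENNReal) p.1 * c p.2) hH
      (hW.prodMk hY), ← compProd_map_condDistrib hY.aemeasurable, Measure.lintegral_compProd hH,
      ← lintegral_map (f := fun w => B.indicator (1 : ℝ → ENNReal) w *
        ∫⁻ y, c y ∂(condDistrib Y W P w)) (hb.mul hk) hW]
    exact lintegral_congr fun w => lintegral_const_mul (B.indicator 1 w) hc
  simp only [mul_one, one_mul] at h2
  rw [h1, h2] at h3
  rw [← lintegral_indicator hB, ← lintegral_indicator hB]
  refine Eq.trans (lintegral_congr fun w => ?_) (h3.trans (lintegral_congr fun w => ?_))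
  · by_cases hw : w ∈ B <;> simp [hw]
  · by_cases hw : w ∈ B <;> simp [hw]

lemma IsJointDensity.moment_le (hq : IsJointDensity P W Y q) (hW : Measurable W)
    (hY : Measurable Y) {η : ℝ} :
    ∀ᵐ w, ∫⁻ y, ENNReal.ofReal (y ^ η) * q w y ∂(P.map Y) ≤
      supCondMoment P Y W η * ∫⁻ y, q w y ∂(P.map Y) := by
  have hle : ∀ᵐ w ∂(P.map W), ∫⁻ y, ENNReal.ofReal (y ^ η) ∂(condDistrib Y W P w) ≤
      supCondMoment P Y W η := ae_le_essSup
  filter_upwards [(hq.ae_map_iff hW).1 hle, hq.lintegral_condDistrib hW hY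
    (c := fun y => ENNReal.ofReal (y ^ η)) (by fun_prop)] with w h1 h2
  rw [h2]
  by_cases h0 : ∫⁻ y, q w y ∂(P.map Y) = 0
  · simp [h0]
  · exact mul_le_mul_left (h1 h0) _

/-- A conditional density on the quadrant, extended by zero to the plane. -/
noncomputable def extendedDensity (f : ℝ → ℝ → ℝ) (x y : ℝ) : ENNReal :=
  (Ici (0 : ℝ) ×ˢ Ici (0 : ℝ)).indicator (fun p : ℝ × ℝ => ENNReal.ofReal (f p.1 p.2)) (x, y)

lemma extendedDensity_of_nonneg {f : ℝ → ℝ → ℝ} {x y : ℝ} (hx : 0 ≤ x) (hy : 0 ≤ y) :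
    extendedDensity f x y = ENNReal.ofReal (f x y) :=
  indicator_of_mem (show (x, y) ∈ Ici (0 : ℝ) ×ˢ Ici (0 : ℝ) from ⟨hx, hy⟩) _

lemma IsMonotoneCondDensity.isJointDensity {X : Ω → ℝ} (hX : Measurable X) (hY : Measurable Y)
    (hY0 : ∀ ω, 0 ≤ Y ω) {f : ℝ → ℝ → ℝ} (hf : IsMonotoneCondDensity P X Y f) :
    IsJointDensity P X Y (extendedDensity f) where
  measurable := by
    have hs : MeasurableSet (Ici (0 : ℝ) ×ˢ Ici (0 : ℝ)) := measurableSet_Ici.prod measurableSet_Ici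
    have h : Measurable ((Ici (0 : ℝ) ×ˢ Ici (0 : ℝ)).indicator
        (fun p : ℝ × ℝ => ENNReal.ofReal (f p.1 p.2))) := by
      classical
      rw [← piecewise_eq_indicator]
      exact ContinuousOn.measurable_piecewise
        (ENNReal.continuous_ofReal.comp_continuousOn hf.cont) continuousOn_const hs
    exact h
  lintegral_eq H hH := by
    rw [← lintegral_map (f := fun p : ℝ × ℝ => H (p.2, p.1)) (hH.comp measurable_swap)
      (hY.prodMk hX), ← compProd_map_condDistrib hX.aemeasurable,
      Measure.lintegral_compProd (f := fun p : ℝ × ℝ => H (p.2, p.1)) (hH.comp measurable_swap)]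
    refine lintegral_congr_ae ?_
    filter_upwards [hf.condDistrib_eq, ae_map_nonneg hY hY0] with y hy hy0
    have hm : AEMeasurable (fun x => ENNReal.ofReal (f x y)) (volume.restrict (Ici 0)) :=
      (aemeasurable_restrict_of_antitoneOn measurableSet_Ici (hf.anti y hy0)).ennreal_ofReal
    rw [hy, lintegral_withDensity_eq_lintegral_mul₀ (g := fun x => H (x, y)) hm
      (hH.comp measurable_prodMk_right).aemeasurable, ← lintegral_indicator measurableSet_Ici]
    refine lintegral_congr fun x => ?_
    by_cases hx : 0 ≤ x
    · simp [extendedDensity, hx, hy0, mul_comm]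
    · simp [extendedDensity, hx]

end

/-! ### Truncated moments and the effect of a shift by `Y` -/

/-- The moment `∫ y ^ j q(y) ν(dy)`; for `q` a conditional density evaluated at `w` and `ν` the law
of `Y`, it is the density of `W` at `w` times `E[Y ^ j | W = w]`. -/
noncomputable def weightedMoment (ν : Measure ℝ) (q : ℝ → ENNReal) (j : ℝ) : ENNReal :=
  ∫⁻ y, ENNReal.ofReal (y ^ j) * q y ∂ν

lemma weightedMoment_zero (ν : Measure ℝ) (q : ℝ → ENNReal) :
    weightedMoment ν q 0 = ∫⁻ y, q y ∂ν := by
  simp [weightedMoment]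

lemma weightedMoment_one (ν : Measure ℝ) (q : ℝ → ENNReal) :
    weightedMoment ν q 1 = ∫⁻ y, ENNReal.ofReal y * q y ∂ν := by
  simp [weightedMoment]

lemma weightedMoment_le_setLIntegral_add (ν : Measure ℝ) (q : ℝ → ENNReal)
    {s j η : ℝ} (hs : 0 < s) (hj : j ≤ η) :
    weightedMoment ν q j ≤ (∫⁻ y in Iic s, ENNReal.ofReal (y ^ j) * q y ∂ν) +
      ENNReal.ofReal (s ^ (j - η)) * weightedMoment ν q η := by
  rw [weightedMoment, ← lintegral_add_compl _ (measurableSet_Iic (a := s))]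
  gcongr
  rw [weightedMoment, ← lintegral_const_mul' _ _ ENNReal.ofReal_ne_top]
  refine le_trans ?_ (setLIntegral_le_lintegral (Iic s)ᶜ _)
  refine setLIntegral_mono' measurableSet_Iic.compl fun y hy => ?_
  have hy : s < y := by simpa using hy
  have hy0 : 0 < y := hs.trans hy
  rw [← mul_assoc, ← ENNReal.ofReal_mul (Real.rpow_nonneg hs.le _)]
  gcongr
  rw [show j = (j - η) + η by ring, Real.rpow_add hy0]
  gcongr ?_ * _
  rw [sub_add_cancel]
  exact Real.rpow_le_rpow_of_nonpos hs hy.le (by linarith)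

lemma weightedMoment_mono {ν : Measure ℝ} {q q' : ℝ → ENNReal} {j : ℝ} {c : ENNReal}
    (hc : c ≠ ⊤) (h : ∀ᵐ y ∂ν, q y ≤ c * q' y) :
    weightedMoment ν q j ≤ c * weightedMoment ν q' j := by
  rw [weightedMoment, weightedMoment, ← lintegral_const_mul' _ _ hc]
  refine lintegral_mono_ae ?_
  filter_upwards [h] with y hy
  calc ENNReal.ofReal (y ^ j) * q y ≤ ENNReal.ofReal (y ^ j) * (c * q' y) := by gcongr
    _ = _ := by ring

lemma weightedMoment_one_le {ν : Measure ℝ} (hν : ∀ᵐ y ∂ν, 0 ≤ y) {q : ℝ → ENNReal}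
    (hq : Measurable q) {η : ℝ} (hη : 1 ≤ η) :
    weightedMoment ν q 1 ≤ weightedMoment ν q 0 + weightedMoment ν q η := by
  rw [weightedMoment_zero, weightedMoment_one, weightedMoment, ← lintegral_add_left hq]
  refine lintegral_mono_ae ?_
  filter_upwards [hν] with y hy
  calc ENNReal.ofReal y * q y ≤ (1 + ENNReal.ofReal (y ^ η)) * q y := by
        gcongr
        rw [← ENNReal.ofReal_one, ← ENNReal.ofReal_add zero_le_one (Real.rpow_nonneg hy _)]
        refine ENNReal.ofReal_le_ofReal ?_
        rcases le_total y 1 with h | h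
        · exact h.trans (le_add_of_nonneg_right (Real.rpow_nonneg hy _))
        · refine le_add_of_nonneg_of_le zero_le_one ?_
          simpa using Real.rpow_le_rpow_of_exponent_le h hη
    _ = _ := by ring

section
variable {Ω : Type*} [MeasurableSpace Ω] {P : Measure Ω} [IsProbabilityMeasure P]
  {X Y : Ω → ℝ} {f : ℝ → ℝ → ℝ}

lemma IsMonotoneCondDensity.measurable_extendedDensity (hf : IsMonotoneCondDensity P X Y f)
    (hX : Measurable X) (hY : Measurable Y) (hY0 : ∀ ω, 0 ≤ Y ω) (x : ℝ) :
    Measurable (extendedDensity f x) :=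
  (hf.isJointDensity hX hY hY0).measurable.comp measurable_prodMk_left

lemma IsMonotoneCondDensity.extendedDensity_anti (hf : IsMonotoneCondDensity P X Y f)
    {a b y : ℝ} (ha : 0 ≤ a) (hab : a ≤ b) (hy : 0 ≤ y) :
    extendedDensity f b y ≤ extendedDensity f a y := by
  rw [extendedDensity_of_nonneg ha hy, extendedDensity_of_nonneg (ha.trans hab) hy]
  exact ENNReal.ofReal_le_ofReal (hf.anti y hy ha (ha.trans hab) hab)

/-- Moving the argument by a small proportion costs a factor close to one, uniformly in `y`. -/
lemma IsMonotoneCondDensity.extendedDensity_mul_le (hf : IsMonotoneCondDensity P X Y f) {κ : ℝ}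
    (hκ : IsUniformlyRegVarying f κ) {δ : ℝ} (hδ : 0 < δ) :
    ∃ t : ℝ, 0 < t ∧ t < 1 ∧ ∀ᶠ z in atTop, ∀ y, 0 ≤ y →
      extendedDensity f (t * z) y ≤ ENNReal.ofReal (1 + δ) * extendedDensity f z y := by
  have hc : Tendsto (fun t : ℝ => t ^ κ) (𝓝[<] 1) (𝓝 1) := by
    have := (Real.continuousAt_rpow_const 1 κ (Or.inl one_ne_zero)).tendsto
    rw [Real.one_rpow] at this
    exact this.mono_left nhdsWithin_le_nhds
  obtain ⟨t, ht1, ht⟩ := ((hc.eventually_lt_const (show (1 : ℝ) < 1 + δ / 2 by linarith)).and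
    (Ioo_mem_nhdsLT (zero_lt_one (α := ℝ)))).exists
  refine ⟨t, ht.1, ht.2, ?_⟩
  filter_upwards [Metric.tendstoUniformlyOn_iff.1 (hκ t ht.1) (δ / 2) (half_pos hδ),
    eventually_ge_atTop 0] with z hz hz0 y hy
  have h := hz y hy
  have hpos := hf.pos z hz0 y hy
  rw [dist_comm, Real.dist_eq] at h
  have h2 : f (t * z) y / f z y ≤ 1 + δ := by linarith [(abs_lt.1 h).2]
  rw [div_le_iff₀ hpos] at h2
  rw [extendedDensity_of_nonneg (mul_nonneg ht.1.le hz0) hy, extendedDensity_of_nonneg hz0 hy,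
    ← ENNReal.ofReal_mul (by linarith)]
  exact ENNReal.ofReal_le_ofReal h2

lemma IsMonotoneCondDensity.weightedMoment_anti (hf : IsMonotoneCondDensity P X Y f)
    {ν : Measure ℝ} (hν : ∀ᵐ y ∂ν, 0 ≤ y) {a b : ℝ} (ha : 0 ≤ a) (hab : a ≤ b) (j : ℝ) :
    weightedMoment ν (extendedDensity f b) j ≤ weightedMoment ν (extendedDensity f a) j := by
  have := weightedMoment_mono (ν := ν) (q := extendedDensity f b) (q' := extendedDensity f a)
    (j := j) ENNReal.one_ne_top
    (hν.mono fun y hy => by rw [one_mul]; exact hf.extendedDensity_anti ha hab hy)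
  rwa [one_mul] at this

lemma exists_mem_Ioo_of_ae {p : ℝ → Prop} (h : ∀ᵐ x, p x) {a b : ℝ} (hab : a < b) :
    ∃ x ∈ Ioo a b, p x := by
  have : (ae (volume.restrict (Ioo a b))).NeBot := by
    rw [ae_restrict_neBot]; simp [hab]
  obtain ⟨x, hx, hp⟩ := ((ae_restrict_mem (μ := volume) (measurableSet_Ioo (a := a) (b := b))).and
    (ae_restrict_of_ae h)).exists
  exact ⟨x, hx, hp⟩

lemma IsMonotoneCondDensity.weightedMoment_zero_lt_top (hf : IsMonotoneCondDensity P X Y f)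
    (hX : Measurable X) (hY : Measurable Y) (hY0 : ∀ ω, 0 ≤ Y ω) {x : ℝ} (hx : 0 < x) :
    weightedMoment (P.map Y) (extendedDensity f x) 0 < ⊤ := by
  obtain ⟨x', hx', h⟩ :=
    exists_mem_Ioo_of_ae (hf.isJointDensity hX hY hY0).marginal_lt_top hx
  refine lt_of_le_of_lt (hf.weightedMoment_anti (ae_map_nonneg hY hY0) hx'.1.le hx'.2.le 0) ?_
  rwa [weightedMoment_zero]

lemma IsMonotoneCondDensity.weightedMoment_zero_pos (hf : IsMonotoneCondDensity P X Y f)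
    (hX : Measurable X) (hY : Measurable Y) (hY0 : ∀ ω, 0 ≤ Y ω) {x : ℝ} (hx : 0 ≤ x) :
    0 < weightedMoment (P.map Y) (extendedDensity f x) 0 := by
  have hprob := Measure.isProbabilityMeasure_map (μ := P) hY.aemeasurable
  rw [weightedMoment_zero, pos_iff_ne_zero, Ne, lintegral_eq_zero_iff
    (hf.measurable_extendedDensity hX hY hY0 x)]
  intro h
  obtain ⟨y, hy, hy0⟩ := (h.and (ae_map_nonneg hY hY0)).exists
  have hy : extendedDensity f x y = 0 := hy
  rw [extendedDensity_of_nonneg hx hy0, ENNReal.ofReal_eq_zero] at hy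
  exact absurd hy (not_le.2 (hf.pos x hx y hy0))

/-- The almost sure moment bound given `X = x` holds at every large `x`, by monotonicity and
regular variation of the densities. -/
lemma IsMonotoneCondDensity.eventually_moment_le (hf : IsMonotoneCondDensity P X Y f)
    (hX : Measurable X) (hY : Measurable Y) (hY0 : ∀ ω, 0 ≤ Y ω) {κ : ℝ}
    (hκ : IsUniformlyRegVarying f κ) {η : ℝ} :
    ∀ᶠ x in atTop, weightedMoment (P.map Y) (extendedDensity f x) η ≤
      (2 * supCondMoment P Y X η) * weightedMoment (P.map Y) (extendedDensity f x) 0 := by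
  obtain ⟨t, ht0, ht1, ht⟩ := hf.extendedDensity_mul_le hκ one_pos
  filter_upwards [ht, eventually_gt_atTop 0] with x hx hx0
  have hν := ae_map_nonneg (P := P) hY hY0
  obtain ⟨x', hx', h⟩ := exists_mem_Ioo_of_ae
    ((hf.isJointDensity hX hY hY0).moment_le hX hY (η := η)) (show t * x < x by nlinarith)
  have htx : 0 ≤ t * x := by positivity
  rw [← weightedMoment_zero _ (extendedDensity f x')] at h
  calc weightedMoment (P.map Y) (extendedDensity f x) η
      ≤ weightedMoment (P.map Y) (extendedDensity f x') η :=
        hf.weightedMoment_anti hν (htx.trans hx'.1.le) hx'.2.le η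
    _ ≤ supCondMoment P Y X η * weightedMoment (P.map Y) (extendedDensity f x') 0 := h
    _ ≤ supCondMoment P Y X η * weightedMoment (P.map Y) (extendedDensity f (t * x)) 0 := by
        gcongr
        exact hf.weightedMoment_anti hν htx hx'.1.le 0
    _ ≤ supCondMoment P Y X η * (2 * weightedMoment (P.map Y) (extendedDensity f x) 0) := by
        gcongr
        refine weightedMoment_mono (by simp) (hν.mono fun y hy => ?_)
        have := hx y hy
        norm_num at this
        exact this
    _ = _ := by ring

lemma IsMonotoneCondDensity.setLIntegral_shift_le (hf : IsMonotoneCondDensity P X Y f)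
    {ν : Measure ℝ} (hν : ∀ᵐ y ∂ν, 0 ≤ y) {t z j : ℝ} {c : ENNReal} (hc : c ≠ ⊤)
    (ht : 0 ≤ t * z)
    (h : ∀ y, 0 ≤ y → extendedDensity f (t * z) y ≤ c * extendedDensity f z y) :
    ∫⁻ y in Iic ((1 - t) * z), ENNReal.ofReal (y ^ j) * extendedDensity f (z - y) y ∂ν ≤
      c * weightedMoment ν (extendedDensity f z) j := by
  rw [weightedMoment, ← lintegral_const_mul' _ _ hc]
  refine le_trans (setLIntegral_mono_ae' measurableSet_Iic ?_) (setLIntegral_le_lintegral _ _)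
  filter_upwards [hν] with y hy0 hy
  have hy : y ≤ (1 - t) * z := hy
  calc ENNReal.ofReal (y ^ j) * extendedDensity f (z - y) y
      ≤ ENNReal.ofReal (y ^ j) * (c * extendedDensity f z y) := by
        gcongr
        exact (hf.extendedDensity_anti ht (by linarith) hy0).trans (h y hy0)
    _ = _ := by ring

lemma IsMonotoneCondDensity.setLIntegral_le_shift (hf : IsMonotoneCondDensity P X Y f)
    {ν : Measure ℝ} (hν : ∀ᵐ y ∂ν, 0 ≤ y) {t z j : ℝ} (ht : 0 ≤ t * z) :
    ∫⁻ y in Iic ((1 - t) * z), ENNReal.ofReal (y ^ j) * extendedDensity f z y ∂ν ≤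
      weightedMoment ν (fun y => extendedDensity f (z - y) y) j := by
  refine le_trans (setLIntegral_mono_ae' measurableSet_Iic ?_) (setLIntegral_le_lintegral _ _)
  filter_upwards [hν] with y hy0 hy
  have hy : y ≤ (1 - t) * z := hy
  gcongr
  exact hf.extendedDensity_anti (by linarith) (by linarith) hy0

lemma eventually_ofReal_rpow_mul_le {ε r : ℝ} (hε : 0 < ε) (hr : r < 0) {C : ENNReal}
    (hC : C ≠ ⊤) {δ : ℝ} (hδ : 0 < δ) :
    ∀ᶠ z : ℝ in atTop, ENNReal.ofReal ((ε * z) ^ r) * C ≤ ENNReal.ofReal δ := by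
  have h1 : Tendsto (fun z : ℝ => (ε * z) ^ r) atTop (𝓝 0) := by
    have := (tendsto_rpow_neg_atTop (show 0 < -r by linarith)).comp
      (tendsto_id.const_mul_atTop hε)
    simpa using! this
  have h2 : Tendsto (fun z : ℝ => ENNReal.ofReal ((ε * z) ^ r) * C) atTop (𝓝 (0 * C)) := by
    refine ENNReal.Tendsto.mul_const ?_ (Or.inr hC)
    simpa using ENNReal.tendsto_ofReal h1
  rw [zero_mul] at h2
  exact (h2.eventually_lt_const (ENNReal.ofReal_pos.2 hδ)).mono fun z hz => hz.le

/-- Replacing `f(z | y)` by `f(z - y | y)` does not change the moments of order `j < η`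
asymptotically: large values of `Y` are negligible by the moment bounds of order `η`, and for
small ones uniform regular variation applies. -/
lemma IsMonotoneCondDensity.eventually_shift (hf : IsMonotoneCondDensity P X Y f)
    (hX : Measurable X) (hY : Measurable Y) (hY0 : ∀ ω, 0 ≤ Y ω) {κ : ℝ}
    (hκ : IsUniformlyRegVarying f κ) {η j : ℝ} (hj : j < η)
    (hmX : supCondMoment P Y X η ≠ ⊤) {C : ENNReal} (hC : C ≠ ⊤) {δ : ℝ} (hδ : 0 < δ) :
    ∀ᶠ z in atTop,
      (weightedMoment (P.map Y) (extendedDensity f z) j ≤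
        weightedMoment (P.map Y) (fun y => extendedDensity f (z - y) y) j +
          ENNReal.ofReal δ * weightedMoment (P.map Y) (extendedDensity f z) 0) ∧
      (weightedMoment (P.map Y) (fun y => extendedDensity f (z - y) y) η ≤
          C * weightedMoment (P.map Y) (fun y => extendedDensity f (z - y) y) 0 →
        weightedMoment (P.map Y) (fun y => extendedDensity f (z - y) y) j ≤
          ENNReal.ofReal (1 + δ) * weightedMoment (P.map Y) (extendedDensity f z) j +
          ENNReal.ofReal δ *
            weightedMoment (P.map Y) (fun y => extendedDensity f (z - y) y) 0) := by
  obtain ⟨t, ht0, ht1, ht⟩ := hf.extendedDensity_mul_le hκ hδ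
  have hν := ae_map_nonneg (P := P) hY hY0
  have ht1' : 0 < 1 - t := by linarith
  filter_upwards [ht, eventually_gt_atTop 0, hf.eventually_moment_le hX hY hY0 hκ (η := η),
    eventually_ofReal_rpow_mul_le ht1' (show j - η < 0 by linarith)
      (ENNReal.mul_ne_top (ENNReal.ofNat_ne_top (n := 2)) hmX) hδ,
    eventually_ofReal_rpow_mul_le ht1' (show j - η < 0 by linarith) hC hδ] with z hz hz0 hm h1 h2
  have hs : 0 < (1 - t) * z := by positivity
  have htz : 0 ≤ t * z := by positivity
  constructor
  · refine (weightedMoment_le_setLIntegral_add _ _ hs hj.le).trans ?_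
    refine add_le_add (hf.setLIntegral_le_shift hν htz) ?_
    calc _ ≤ ENNReal.ofReal (((1 - t) * z) ^ (j - η)) * ((2 * supCondMoment P Y X η) *
          weightedMoment (P.map Y) (extendedDensity f z) 0) := by gcongr
      _ ≤ _ := by rw [← mul_assoc]; gcongr
  · intro hmZ
    refine (weightedMoment_le_setLIntegral_add _ _ hs hj.le).trans ?_
    refine add_le_add (hf.setLIntegral_shift_le hν ENNReal.ofReal_ne_top htz hz) ?_
    calc _ ≤ ENNReal.ofReal (((1 - t) * z) ^ (j - η)) * (C *
          weightedMoment (P.map Y) (fun y => extendedDensity f (z - y) y) 0) := by gcongr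
      _ ≤ _ := by rw [← mul_assoc]; gcongr

end

/-! ### The excess of the tail of `X + Y` over the tail of `X` -/

section
variable {Ω : Type*} [MeasurableSpace Ω] {P : Measure Ω} [IsProbabilityMeasure P]
  {X Y : Ω → ℝ} {f : ℝ → ℝ → ℝ}

/-- The real-valued moment `∫ y ^ j f(x | y) P_Y(dy)`. For `j = 0` this is the density of `X`. -/
noncomputable def momentFun (P : Measure Ω) (Y : Ω → ℝ) (f : ℝ → ℝ → ℝ) (j x : ℝ) : ℝ :=
  (weightedMoment (P.map Y) (extendedDensity f x) j).toReal

lemma tailFun_sub_tailFun {V W : Ω → ℝ} (hW : Measurable W) {x z : ℝ}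
    (h : ∀ ω, z < W ω → x < V ω) :
    tailFun P V x - tailFun P W z = P.real {ω | W ω ≤ z ∧ x < V ω} := by
  have h1 : {ω | W ω ≤ z ∧ x < V ω} = {ω | x < V ω} \ {ω | z < W ω} := by
    ext ω; simp [and_comm]
  have h2 : {ω | z < W ω} ⊆ {ω | x < V ω} := fun ω hω => h ω hω
  rw [h1, measureReal_sdiff h2 (measurableSet_lt measurable_const hW)]
  rfl

lemma IsMonotoneCondDensity.tailFun_sub_bounds (hf : IsMonotoneCondDensity P X Y f)
    (hX : Measurable X) (hY : Measurable Y) (hY0 : ∀ ω, 0 ≤ Y ω) {x z : ℝ} (hx : 0 < x)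
    (hxz : x ≤ z) :
    momentFun P Y f 0 z * (z - x) ≤ tailFun P X x - tailFun P X z ∧
      tailFun P X x - tailFun P X z ≤ momentFun P Y f 0 x * (z - x) := by
  have hν := ae_map_nonneg (P := P) hY hY0
  have hq := hf.isJointDensity hX hY hY0
  rw [tailFun_sub_tailFun hX fun ω hω => hxz.trans_lt hω]
  have hset : P {ω | X ω ≤ z ∧ x < X ω} =
      ∫⁻ w in Ioc x z, weightedMoment (P.map Y) (extendedDensity f w) 0 := by
    simp_rw [weightedMoment_zero]
    rw [← withDensity_apply _ measurableSet_Ioc, ← hq.map_eq hX,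
      Measure.map_apply hX measurableSet_Ioc]
    congr 1
    ext ω
    exact and_comm
  have hlow : weightedMoment (P.map Y) (extendedDensity f z) 0 * ENNReal.ofReal (z - x) ≤
      P {ω | X ω ≤ z ∧ x < X ω} := by
    rw [hset, ← Real.volume_Ioc, ← setLIntegral_const]
    exact setLIntegral_mono' measurableSet_Ioc fun w hw =>
      hf.weightedMoment_anti hν (hx.le.trans hw.1.le) hw.2 0
  have hup : P {ω | X ω ≤ z ∧ x < X ω} ≤
      weightedMoment (P.map Y) (extendedDensity f x) 0 * ENNReal.ofReal (z - x) := by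
    rw [hset, ← Real.volume_Ioc, ← setLIntegral_const]
    exact setLIntegral_mono' measurableSet_Ioc fun w hw =>
      hf.weightedMoment_anti hν hx.le hw.1.le 0
  have hfin := (hf.weightedMoment_zero_lt_top hX hY hY0 hx).ne
  constructor
  · have := ENNReal.toReal_mono (measure_ne_top _ _) hlow
    rwa [ENNReal.toReal_mul, ENNReal.toReal_ofReal (by linarith)] at this
  · have := ENNReal.toReal_mono (ENNReal.mul_ne_top hfin ENNReal.ofReal_ne_top) hup
    rwa [ENNReal.toReal_mul, ENNReal.toReal_ofReal (by linarith)] at this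

/-- The heavy tail of `X` forces its density to dominate the tail of `Y`, as `β + 1 < γ`. -/
lemma IsMonotoneCondDensity.eventually_tailFun_le (hf : IsMonotoneCondDensity P X Y f)
    (hX : Measurable X) (hY : Measurable Y) (hY0 : ∀ ω, 0 ≤ Y ω) {β γ : ℝ} (hβ : 0 < β)
    (hβγ : β + 1 < γ) (hXtail : IsRegVarying (tailFun P X) (-β))
    (hYtail : IsRegVarying (tailFun P Y) (-γ)) {ε δ : ℝ} (hε : 0 < ε) (hδ : 0 < δ) :
    ∀ᶠ z in atTop, tailFun P Y (ε * z) ≤ δ * momentFun P Y f 0 z := by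
  obtain ⟨s, hs1, hs2⟩ := exists_between (show β < γ - 1 by linarith)
  obtain ⟨r, hr1, hr2⟩ := exists_between (show s + 1 < γ by linarith)
  obtain ⟨c, x₀, hc, -, hcx⟩ :=
    hXtail.exists_rpow_le (antitone_tailFun X) (by linarith) hs1
  obtain ⟨C, y₀, hC, -, hCy⟩ :=
    hYtail.exists_le_rpow (antitone_tailFun Y) (by linarith) hr2
  obtain ⟨θ, hθ1, hθ2⟩ := exists_between
    (show (2 : ℝ) ^ (-β) < 1 from Real.rpow_lt_one_of_one_lt_of_neg one_lt_two (by linarith))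
  have hlim : Tendsto (fun z : ℝ => C * ε ^ (-r) * z ^ (-(r - s - 1))) atTop (𝓝 0) := by
    simpa using (tendsto_rpow_neg_atTop (show 0 < r - s - 1 by linarith)).const_mul
      (C * ε ^ (-r))
  filter_upwards [(hXtail.2 2 two_pos).eventually_lt_const hθ1, eventually_gt_atTop 0,
    eventually_ge_atTop x₀, (tendsto_id.const_mul_atTop hε).eventually_ge_atTop y₀,
    hlim.eventually_lt_const (show 0 < δ * (1 - θ) * c by
      have : 0 < 1 - θ := by linarith
      positivity)] with z h2z hz0 hzx hzy hz
  have hY1 : tailFun P Y (ε * z) ≤ C * (ε * z) ^ (-r) := hCy _ hzy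
  have hX1 := hcx z hzx
  have hXpos : 0 < tailFun P X z := lt_of_lt_of_le (by positivity) hX1
  rw [div_lt_iff₀ hXpos] at h2z
  have hb := (hf.tailFun_sub_bounds hX hY hY0 hz0 (show z ≤ 2 * z by linarith)).2
  have hdens : (1 - θ) * (c * z ^ (-s)) ≤ momentFun P Y f 0 z * z := by
    calc (1 - θ) * (c * z ^ (-s)) ≤ (1 - θ) * tailFun P X z := by
          have : 0 ≤ 1 - θ := by linarith
          gcongr
      _ ≤ tailFun P X z - tailFun P X (2 * z) := by linarith
      _ ≤ momentFun P Y f 0 z * (2 * z - z) := hb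
      _ = _ := by ring
  have hmul : C * (ε * z) ^ (-r) * z ≤ δ * momentFun P Y f 0 z * z := by
    calc C * (ε * z) ^ (-r) * z = (C * ε ^ (-r) * z ^ (-(r - s - 1))) * z ^ (-s) := by
          rw [Real.mul_rpow hε.le hz0.le]
          have : z ^ (-r) * z = z ^ (-(r - s - 1)) * z ^ (-s) := by
            rw [← Real.rpow_add hz0, ← Real.rpow_add_one hz0.ne']
            congr 1; ring
          calc C * (ε ^ (-r) * z ^ (-r)) * z = C * ε ^ (-r) * (z ^ (-r) * z) := by ring
            _ = _ := by rw [this]; ring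
      _ ≤ (δ * (1 - θ) * c) * z ^ (-s) := by gcongr
      _ = δ * ((1 - θ) * (c * z ^ (-s))) := by ring
      _ ≤ δ * (momentFun P Y f 0 z * z) := by gcongr
      _ = _ := by ring
  exact hY1.trans (le_of_mul_le_mul_right hmul hz0)

lemma IsMonotoneCondDensity.measure_excess (hf : IsMonotoneCondDensity P X Y f)
    (hX : Measurable X) (hY : Measurable Y) (hY0 : ∀ ω, 0 ≤ Y ω) (z : ℝ) :
    P {ω | X ω ≤ z ∧ z < (X + Y) ω} =
      ∫⁻ y, (∫⁻ x in Ioc (z - y) z, extendedDensity f x y) ∂(P.map Y) := by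
  have hS : MeasurableSet {p : ℝ × ℝ | p.1 ≤ z ∧ z < p.1 + p.2} :=
    (measurableSet_le measurable_fst measurable_const).inter
      (measurableSet_lt measurable_const (measurable_fst.add measurable_snd))
  have h := (hf.isJointDensity hX hY hY0).lintegral_eq
    ({p : ℝ × ℝ | p.1 ≤ z ∧ z < p.1 + p.2}.indicator 1) (measurable_one.indicator hS)
  have hS' : MeasurableSet {ω | X ω ≤ z ∧ z < (X + Y) ω} :=
    (measurableSet_le hX measurable_const).inter (measurableSet_lt measurable_const (hX.add hY))
  rw [← lintegral_indicator_one hS']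
  refine h.trans (lintegral_congr fun y => ?_)
  rw [← lintegral_indicator measurableSet_Ioc]
  refine lintegral_congr fun x => ?_
  have hiff : x ∈ Ioc (z - y) z ↔ x ≤ z ∧ z < x + y := by
    rw [mem_Ioc, and_comm, sub_lt_iff_lt_add]
  by_cases hx : x ∈ Ioc (z - y) z
  · simp [hx, hiff.1 hx]
  · simp only [indicator_of_notMem hx]
    rw [hiff] at hx
    simp [hx]

lemma IsMonotoneCondDensity.lintegral_extendedDensity (hf : IsMonotoneCondDensity P X Y f)
    {y : ℝ} (hy : 0 ≤ y) : ∫⁻ x, extendedDensity f x y = 1 := by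
  rw [← hf.total y hy, ← lintegral_indicator measurableSet_Ici]
  refine lintegral_congr fun x => ?_
  by_cases hx : 0 ≤ x <;> simp [extendedDensity, hx, hy]

lemma IsMonotoneCondDensity.setLIntegral_le_excess (hf : IsMonotoneCondDensity P X Y f)
    (hX : Measurable X) (hY : Measurable Y) (hY0 : ∀ ω, 0 ≤ Y ω) {t z : ℝ} (ht : 0 ≤ t * z) :
    ∫⁻ y in Iic ((1 - t) * z), ENNReal.ofReal (y ^ (1 : ℝ)) * extendedDensity f z y ∂(P.map Y) ≤
      P {ω | X ω ≤ z ∧ z < (X + Y) ω} := by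
  rw [hf.measure_excess hX hY hY0]
  refine le_trans (setLIntegral_mono_ae' measurableSet_Iic ?_) (setLIntegral_le_lintegral _ _)
  filter_upwards [ae_map_nonneg (P := P) hY hY0] with y hy0 hy
  have hy : y ≤ (1 - t) * z := hy
  calc ENNReal.ofReal (y ^ (1 : ℝ)) * extendedDensity f z y
      = ∫⁻ _ in Ioc (z - y) z, extendedDensity f z y := by
        rw [setLIntegral_const, Real.volume_Ioc, sub_sub_cancel, Real.rpow_one, mul_comm]
    _ ≤ _ := setLIntegral_mono' measurableSet_Ioc fun x hx =>
        hf.extendedDensity_anti (by linarith [hx.1]) hx.2 hy0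

lemma IsMonotoneCondDensity.excess_le (hf : IsMonotoneCondDensity P X Y f)
    (hX : Measurable X) (hY : Measurable Y) (hY0 : ∀ ω, 0 ≤ Y ω) {t z : ℝ} {c : ENNReal}
    (hc : c ≠ ⊤) (ht : 0 ≤ t * z)
    (h : ∀ y, 0 ≤ y → extendedDensity f (t * z) y ≤ c * extendedDensity f z y) :
    P {ω | X ω ≤ z ∧ z < (X + Y) ω} ≤
      c * weightedMoment (P.map Y) (extendedDensity f z) 1 + P {ω | (1 - t) * z < Y ω} := by
  have hν := ae_map_nonneg (P := P) hY hY0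
  rw [hf.measure_excess hX hY hY0, ← lintegral_add_compl _ (measurableSet_Iic (a := (1 - t) * z))]
  refine add_le_add ?_ ?_
  · rw [weightedMoment, ← lintegral_const_mul' _ _ hc]
    refine le_trans (setLIntegral_mono_ae' measurableSet_Iic ?_) (setLIntegral_le_lintegral _ _)
    filter_upwards [hν] with y hy0 hy
    have hy : y ≤ (1 - t) * z := hy
    calc ∫⁻ x in Ioc (z - y) z, extendedDensity f x y
        ≤ ∫⁻ _ in Ioc (z - y) z, c * extendedDensity f z y :=
          setLIntegral_mono' measurableSet_Ioc fun x hx =>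
            (hf.extendedDensity_anti ht (by linarith [hx.1]) hy0).trans (h y hy0)
      _ = _ := by
          rw [setLIntegral_const, Real.volume_Ioc, sub_sub_cancel, Real.rpow_one]
          ring
  · calc ∫⁻ y in (Iic ((1 - t) * z))ᶜ, (∫⁻ x in Ioc (z - y) z, extendedDensity f x y) ∂(P.map Y)
        ≤ ∫⁻ _ in (Iic ((1 - t) * z))ᶜ, 1 ∂(P.map Y) := by
          refine setLIntegral_mono_ae' measurableSet_Iic.compl ?_
          filter_upwards [hν] with y hy0 _
          exact (setLIntegral_le_lintegral _ _).trans (hf.lintegral_extendedDensity hy0).le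
      _ = P {ω | (1 - t) * z < Y ω} := by
          rw [setLIntegral_one, compl_Iic, Measure.map_apply hY measurableSet_Ioi]
          rfl

end

/-! ### Quantile gap and regression functions -/

/-- The estimates behind the quantile gap `d`: with densities `a`, first moments `b` and tail
excess `D`, the gap agrees with the regression value `b / a` up to a multiple of `δ`. -/
lemma gap_estimate {δ K az ax bz bx d D : ℝ} (hδ : 0 < δ) (hδ1 : δ ≤ 1) (hK : 0 ≤ K)
    (haz : 0 < az) (ha1 : az ≤ ax) (ha2 : ax ≤ (1 + δ) * az) (hb0 : 0 ≤ bz) (hb1 : bz ≤ bx)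
    (hb2 : bx ≤ (1 + δ) * bz) (hbK : bz ≤ K * az) (hd : 0 ≤ d) (hD1 : az * d ≤ D)
    (hD2 : D ≤ ax * d) (hD3 : bz ≤ D + δ * az) (hD4 : D ≤ (1 + δ) * bz + δ * az) :
    |bx / ax - d| ≤ δ * (4 * K + 2) ∧ |bx / ax - bz / az| ≤ δ * (2 * K) := by
  have hax : 0 < ax := haz.trans_le ha1
  set gz := bz / az with hgz
  set gx := bx / ax with hgx
  have hbz : bz = gz * az := (div_mul_cancel₀ bz haz.ne').symm
  have hbx : bx = gx * ax := (div_mul_cancel₀ bx hax.ne').symm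
  have hgz0 : 0 ≤ gz := div_nonneg hb0 haz.le
  have hgx0 : 0 ≤ gx := div_nonneg (hb0.trans hb1) hax.le
  have hgzK : gz ≤ K := (div_le_iff₀ haz).2 hbK
  have h1 : gx ≤ (1 + δ) * gz := by
    rw [hgx, div_le_iff₀ hax]
    calc bx ≤ (1 + δ) * gz * az := by rw [hbz] at hb2; linarith
      _ ≤ (1 + δ) * gz * ax := by gcongr
  have h2 : gz ≤ (1 + δ) * gx := by
    rw [hgz, div_le_iff₀ haz]
    calc bz ≤ gx * ax := by rw [← hbx]; exact hb1
      _ ≤ gx * ((1 + δ) * az) := by gcongr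
      _ = _ := by ring
  have h3 : d ≤ (1 + δ) * gz + δ := by
    refine le_of_mul_le_mul_left ?_ haz
    rw [hbz] at hD4
    linarith
  have h4 : gz ≤ (1 + δ) * d + δ := by
    refine le_of_mul_le_mul_right ?_ haz
    have : ax * d ≤ (1 + δ) * az * d := by gcongr
    rw [hbz] at hD3
    linarith
  have h5 : δ * gz ≤ δ * K := by gcongr
  have h6 : gx ≤ 2 * K := by nlinarith
  have h7 : δ * gx ≤ δ * (2 * K) := by gcongr
  have h8 : d ≤ 2 * K + 1 := by nlinarith
  have h9 : δ * d ≤ δ * (2 * K + 1) := by gcongr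
  have h10 : 0 ≤ δ * K := by positivity
  constructor <;> rw [abs_le] <;> constructor <;> linarith

/-- The regression value `k = E[Y | X + Y = z]` is compared with `b / a = E[Y | X = z]`, where `a`
and `c` are the densities of `X` and `X + Y` at `z`. -/
lemma regression_estimate {δ K a b c k : ℝ} (hδ : 0 < δ) (hδ1 : δ ≤ 1 / 2) (hK : 0 ≤ K)
    (ha : 0 < a) (hb0 : 0 ≤ b) (hbK : b ≤ K * a) (hc1 : c ≤ (1 + δ) * a + δ * c)
    (hc2 : a ≤ c + δ * a) (hk1 : k * c ≤ (1 + δ) * b + δ * c) (hk2 : b ≤ k * c + δ * a)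
    (hk0 : 0 ≤ k) : |b / a - k| ≤ δ * (20 * K + 5) := by
  set g := b / a with hg
  have hb : b = g * a := (div_mul_cancel₀ b ha.ne').symm
  have hg0 : 0 ≤ g := div_nonneg hb0 ha.le
  have hgK : g ≤ K := (div_le_iff₀ ha).2 hbK
  have hδ2 : 0 < 1 - δ := by linarith
  have hc : 0 < c := by nlinarith
  have hac : a ≤ (1 + 2 * δ) * c := by
    refine le_of_mul_le_mul_left ?_ hδ2
    nlinarith [mul_nonneg hδ.le (mul_nonneg hc.le (show 0 ≤ 1 - 2 * δ by linarith))]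
  have hca : c ≤ (1 + 4 * δ) * a := by
    refine le_of_mul_le_mul_left ?_ hδ2
    nlinarith [mul_nonneg hδ.le (mul_nonneg ha.le (show 0 ≤ 1 - 2 * δ by linarith))]
  have h1 : k ≤ (1 + δ) * (1 + 2 * δ) * g + δ := by
    refine le_of_mul_le_mul_right ?_ hc
    rw [hb] at hk1
    have : (1 + δ) * g * a ≤ (1 + δ) * g * ((1 + 2 * δ) * c) := by gcongr
    linarith
  have h2 : g ≤ k * (1 + 4 * δ) + δ := by
    refine le_of_mul_le_mul_right ?_ ha
    rw [hb] at hk2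
    have : k * c ≤ k * ((1 + 4 * δ) * a) := by gcongr
    linarith
  have h3 : (1 + δ) * (1 + 2 * δ) ≤ 1 + 4 * δ := by nlinarith
  have h4 : k ≤ (1 + 4 * δ) * g + δ := h1.trans (by gcongr)
  have h5 : δ * g ≤ δ * K := by gcongr
  have h6 : k ≤ 3 * K + 1 := by nlinarith
  have h7 : δ * k ≤ δ * (3 * K + 1) := by gcongr
  have h8 : 0 ≤ δ * K := by positivity
  rw [abs_le]
  constructor <;> linarith

section
variable {Ω : Type*} [MeasurableSpace Ω] {P : Measure Ω} {X Y : Ω → ℝ} {f : ℝ → ℝ → ℝ}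

lemma momentFun_nonneg (j x : ℝ) : 0 ≤ momentFun P Y f j x := ENNReal.toReal_nonneg

variable [IsProbabilityMeasure P]

lemma IsMonotoneCondDensity.momentFun_zero_pos (hf : IsMonotoneCondDensity P X Y f)
    (hX : Measurable X) (hY : Measurable Y) (hY0 : ∀ ω, 0 ≤ Y ω) {x : ℝ} (hx : 0 < x) :
    0 < momentFun P Y f 0 x :=
  ENNReal.toReal_pos (hf.weightedMoment_zero_pos hX hY hY0 hx.le).ne'
    (hf.weightedMoment_zero_lt_top hX hY hY0 hx).ne

lemma IsMonotoneCondDensity.eventually_weightedMoment_one_le (hf : IsMonotoneCondDensity P X Y f)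
    (hX : Measurable X) (hY : Measurable Y) (hY0 : ∀ ω, 0 ≤ Y ω) {κ : ℝ}
    (hκ : IsUniformlyRegVarying f κ) {η : ℝ} (hη : 1 ≤ η) :
    ∀ᶠ x in atTop, weightedMoment (P.map Y) (extendedDensity f x) 1 ≤
      (1 + 2 * supCondMoment P Y X η) * weightedMoment (P.map Y) (extendedDensity f x) 0 := by
  filter_upwards [hf.eventually_moment_le hX hY hY0 hκ (η := η)] with x hx
  refine (weightedMoment_one_le (ae_map_nonneg hY hY0)
    (hf.measurable_extendedDensity hX hY hY0 x) hη).trans ?_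
  rw [add_mul, one_mul]
  gcongr

lemma toReal_le_mul_add {A B C : ENNReal} {r s : ℝ} (hr : 0 ≤ r) (hs : 0 ≤ s) (hB : B ≠ ⊤)
    (hC : C ≠ ⊤) (h : A ≤ ENNReal.ofReal r * B + ENNReal.ofReal s * C) :
    A.toReal ≤ r * B.toReal + s * C.toReal := by
  have h1 : ENNReal.ofReal r * B ≠ ⊤ := ENNReal.mul_ne_top ENNReal.ofReal_ne_top hB
  have h2 : ENNReal.ofReal s * C ≠ ⊤ := ENNReal.mul_ne_top ENNReal.ofReal_ne_top hC
  have := ENNReal.toReal_mono (ENNReal.add_ne_top.2 ⟨h1, h2⟩) h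
  rwa [ENNReal.toReal_add h1 h2, ENNReal.toReal_mul, ENNReal.toReal_mul, ENNReal.toReal_ofReal hr,
    ENNReal.toReal_ofReal hs] at this

/-- The excess of the tail of `X + Y` at `z` is asymptotically `E[Y f(z | Y)]`, up to an error
small against the density of `X`. -/
lemma IsMonotoneCondDensity.eventually_excess (hf : IsMonotoneCondDensity P X Y f)
    (hX : Measurable X) (hY : Measurable Y) (hY0 : ∀ ω, 0 ≤ Y ω) {κ : ℝ}
    (hκ : IsUniformlyRegVarying f κ) {η : ℝ} (hη : 1 < η) (hmX : supCondMoment P Y X η ≠ ⊤)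
    {β γ : ℝ} (hβ : 0 < β) (hβγ : β + 1 < γ) (hXtail : IsRegVarying (tailFun P X) (-β))
    (hYtail : IsRegVarying (tailFun P Y) (-γ)) {δ : ℝ} (hδ : 0 < δ) :
    ∀ᶠ z in atTop,
      momentFun P Y f 1 z ≤
        (tailFun P (X + Y) z - tailFun P X z) + δ * momentFun P Y f 0 z ∧
      tailFun P (X + Y) z - tailFun P X z ≤
        (1 + δ) * momentFun P Y f 1 z + δ * momentFun P Y f 0 z := by
  obtain ⟨t, ht0, ht1, ht⟩ := hf.extendedDensity_mul_le hκ hδ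
  have ht1' : 0 < 1 - t := by linarith
  filter_upwards [ht, eventually_gt_atTop 0, hf.eventually_moment_le hX hY hY0 hκ (η := η),
    hf.eventually_weightedMoment_one_le hX hY hY0 hκ hη.le,
    eventually_ofReal_rpow_mul_le ht1' (show 1 - η < 0 by linarith)
      (ENNReal.mul_ne_top (ENNReal.ofNat_ne_top (n := 2)) hmX) hδ,
    hf.eventually_tailFun_le hX hY hY0 hβ hβγ hXtail hYtail ht1' hδ] with z hz hz0 hm hm1 h1 hYz
  have hs : 0 < (1 - t) * z := by positivity
  have htz : 0 ≤ t * z := by positivity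
  have hfin0 := (hf.weightedMoment_zero_lt_top hX hY hY0 hz0).ne
  have hfin1 : weightedMoment (P.map Y) (extendedDensity f z) 1 ≠ ⊤ :=
    ne_top_of_le_ne_top (ENNReal.mul_ne_top (by finiteness) hfin0) hm1
  have hD : tailFun P (X + Y) z - tailFun P X z = P.real {ω | X ω ≤ z ∧ z < (X + Y) ω} :=
    tailFun_sub_tailFun hX fun ω hω => hω.trans_le (by simpa using hY0 ω)
  rw [hD]
  constructor
  · have := toReal_le_mul_add (A := weightedMoment (P.map Y) (extendedDensity f z) 1)
      (B := P {ω | X ω ≤ z ∧ z < (X + Y) ω}) zero_le_one hδ.le (measure_ne_top _ _) hfin0 ?_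
    · rwa [one_mul] at this
    · refine (weightedMoment_le_setLIntegral_add _ _ hs hη.le).trans ?_
      rw [ENNReal.ofReal_one, one_mul]
      refine add_le_add (hf.setLIntegral_le_excess hX hY hY0 htz) ?_
      calc _ ≤ ENNReal.ofReal (((1 - t) * z) ^ (1 - η)) * ((2 * supCondMoment P Y X η) *
            weightedMoment (P.map Y) (extendedDensity f z) 0) := by gcongr
        _ ≤ _ := by rw [← mul_assoc]; gcongr
  · have h := hf.excess_le hX hY hY0 ENNReal.ofReal_ne_top htz hz
    have := toReal_le_mul_add (A := P {ω | X ω ≤ z ∧ z < (X + Y) ω})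
      (C := P {ω | (1 - t) * z < Y ω}) (s := 1)
      (show 0 ≤ 1 + δ by linarith) zero_le_one hfin1 (measure_ne_top _ _)
      (by rw [ENNReal.ofReal_one, one_mul]; exact h)
    rw [one_mul] at this
    exact this.trans (add_le_add le_rfl hYz)

/-- At equal tail probabilities, the quantile gap `z - x` is asymptotically the regression
function `E[Y | X = x]`, which varies slowly enough not to distinguish `x` from `z`. -/
lemma IsMonotoneCondDensity.eventually_gap (hf : IsMonotoneCondDensity P X Y f)
    (hX : Measurable X) (hY : Measurable Y) (hY0 : ∀ ω, 0 ≤ Y ω) {κ : ℝ}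
    (hκ : IsUniformlyRegVarying f κ) {η : ℝ} (hη : 1 < η) (hmX : supCondMoment P Y X η ≠ ⊤)
    {β γ : ℝ} (hβ : 0 < β) (hβγ : β + 1 < γ) (hXtail : IsRegVarying (tailFun P X) (-β))
    (hYtail : IsRegVarying (tailFun P Y) (-γ)) {ε : ℝ} (hε : 0 < ε) :
    ∀ᶠ z in atTop, ∀ x, 0 < x → x ≤ z → tailFun P X x = tailFun P (X + Y) z →
      |momentFun P Y f 1 x / momentFun P Y f 0 x - (z - x)| ≤ ε ∧
      |momentFun P Y f 1 x / momentFun P Y f 0 x -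
        momentFun P Y f 1 z / momentFun P Y f 0 z| ≤ ε := by
  set K : ℝ := (1 + 2 * supCondMoment P Y X η).toReal with hKdef
  have hK : 0 ≤ K := ENNReal.toReal_nonneg
  set δ : ℝ := min 1 (ε / (4 * K + 2)) with hδdef
  have hK2 : 0 < 4 * K + 2 := by positivity
  have hδ : 0 < δ := lt_min one_pos (by positivity)
  have hδ1 : δ ≤ 1 := min_le_left _ _
  have hδε : δ * (4 * K + 2) ≤ ε := (le_div_iff₀ hK2).1 (min_le_right _ _)
  obtain ⟨t, ht0, ht1, ht⟩ := hf.extendedDensity_mul_le hκ hδ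
  have hν := ae_map_nonneg (P := P) hY hY0
  have hm1 := hf.eventually_weightedMoment_one_le hX hY hY0 hκ hη.le
  have hid : Tendsto (fun z : ℝ => (1 - t) * z) atTop atTop :=
    tendsto_id.const_mul_atTop (by linarith)
  have hid2 : Tendsto (fun z : ℝ => t * z) atTop atTop := tendsto_id.const_mul_atTop ht0
  filter_upwards [ht, hm1, hid2.eventually hm1, eventually_gt_atTop 0,
    hid.eventually_ge_atTop (2 * K + 1),
    hf.eventually_excess hX hY hY0 hκ hη hmX hβ hβγ hXtail hYtail hδ]
    with z hz hmz hmt hz0 hzK hDz x hx0 hxz htail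
  have htz : 0 < t * z := by positivity
  have hfin : ∀ w, 0 < w → weightedMoment (P.map Y) (extendedDensity f w) 0 ≠ ⊤ := fun w hw =>
    (hf.weightedMoment_zero_lt_top hX hY hY0 hw).ne
  have hfint : weightedMoment (P.map Y) (extendedDensity f (t * z)) 1 ≠ ⊤ :=
    ne_top_of_le_ne_top (ENNReal.mul_ne_top (by finiteness) (hfin _ htz)) hmt
  have hfinz : weightedMoment (P.map Y) (extendedDensity f z) 1 ≠ ⊤ :=
    ne_top_of_le_ne_top (ENNReal.mul_ne_top (by finiteness) (hfin _ hz0)) hmz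
  have haz := hf.momentFun_zero_pos hX hY hY0 hz0
  have hbK : momentFun P Y f 1 z ≤ K * momentFun P Y f 0 z := by
    have := ENNReal.toReal_mono (ENNReal.mul_ne_top (by finiteness) (hfin _ hz0)) hmz
    rwa [ENNReal.toReal_mul] at this
  have hb0 : 0 ≤ momentFun P Y f 1 z := momentFun_nonneg 1 z
  obtain ⟨hD1, hD2⟩ := hf.tailFun_sub_bounds hX hY hY0 hx0 hxz
  rw [htail] at hD1 hD2
  have hd : 0 ≤ z - x := by linarith
  -- the gap is bounded, so `x` lies in the range `[t z, z]` where densities are nearly constant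
  have hdK : z - x ≤ 2 * K + 1 := by
    refine le_of_mul_le_mul_left ?_ haz
    have h1 := hD1.trans hDz.2
    have h2 : (1 + δ) * momentFun P Y f 1 z ≤ 2 * (K * momentFun P Y f 0 z) := by
      gcongr; linarith
    have h3 : δ * momentFun P Y f 0 z ≤ 1 * momentFun P Y f 0 z := by gcongr
    linarith
  have hxt : t * z ≤ x := by linarith
  have hup : ∀ j, weightedMoment (P.map Y) (extendedDensity f z) j ≠ ⊤ →
      momentFun P Y f j x ≤ (1 + δ) * momentFun P Y f j z := by
    intro j hj
    have h1 : weightedMoment (P.map Y) (extendedDensity f x) j ≤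
        ENNReal.ofReal (1 + δ) * weightedMoment (P.map Y) (extendedDensity f z) j :=
      (hf.weightedMoment_anti hν htz.le hxt j).trans
        (weightedMoment_mono ENNReal.ofReal_ne_top (hν.mono hz))
    have := ENNReal.toReal_mono (ENNReal.mul_ne_top ENNReal.ofReal_ne_top hj) h1
    rwa [ENNReal.toReal_mul, ENNReal.toReal_ofReal (by linarith)] at this
  have hfinx : weightedMoment (P.map Y) (extendedDensity f x) 1 ≠ ⊤ :=
    ne_top_of_le_ne_top hfint (hf.weightedMoment_anti hν htz.le hxt 1)
  obtain ⟨h1, h2⟩ := gap_estimate hδ hδ1 hK haz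
    (ENNReal.toReal_mono (hfin x hx0) (hf.weightedMoment_anti hν hx0.le hxz 0))
    (hup 0 (hfin z hz0)) hb0
    (ENNReal.toReal_mono hfinx (hf.weightedMoment_anti hν hx0.le hxz 1))
    (hup 1 hfinz) hbK hd hD1 hD2 hDz.1 hDz.2
  refine ⟨h1.trans hδε, h2.trans (le_trans ?_ hδε)⟩
  gcongr
  linarith

/-- The regression function of `Y` on `W`, read off from the joint density. -/
lemma IsJointDensity.regression {W : Ω → ℝ} {q : ℝ → ℝ → ENNReal} (hq : IsJointDensity P W Y q)
    (hW : Measurable W) (hY : Measurable Y) (hY0 : ∀ ω, 0 ≤ Y ω) {η : ℝ} (hη : 1 ≤ η)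
    (hm : supCondMoment P Y W η ≠ ⊤) :
    ∀ᵐ w ∂(P.map W),
      0 ≤ ∫ y, y ∂(condDistrib Y W P w) ∧
      ∫ y, y ∂(condDistrib Y W P w) ≤ (1 + supCondMoment P Y W η).toReal ∧
      (∫ y, y ∂(condDistrib Y W P w)) * (weightedMoment (P.map Y) (q w) 0).toReal =
        (weightedMoment (P.map Y) (q w) 1).toReal := by
  have hneg : ∀ᵐ w ∂(P.map W), ∀ᵐ y ∂(condDistrib Y W P w), 0 ≤ y := by
    have h : ∀ᵐ p ∂(P.map W ⊗ₘ condDistrib Y W P), 0 ≤ p.2 := by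
      rw [compProd_map_condDistrib hY.aemeasurable]
      exact (MeasureTheory.ae_map_iff (hW.prodMk hY).aemeasurable (measurableSet_le measurable_const
        measurable_snd)).2 (ae_of_all _ hY0)
    exact Measure.ae_ae_of_ae_compProd h
  have hle : ∀ᵐ w ∂(P.map W), ∫⁻ y, ENNReal.ofReal (y ^ η) ∂(condDistrib Y W P w) ≤
      supCondMoment P Y W η := ae_le_essSup
  have hbayes := (hq.ae_map_iff hW).2 ((hq.lintegral_condDistrib hW hY
    (c := fun y => ENNReal.ofReal y) (by fun_prop)).mono fun w hw _ => hw)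
  filter_upwards [hneg, hle, hbayes] with w hw0 hwm hwb
  have hk : ∫ y, y ∂(condDistrib Y W P w) =
      (∫⁻ y, ENNReal.ofReal y ∂(condDistrib Y W P w)).toReal :=
    integral_eq_lintegral_of_nonneg_ae hw0 measurable_id.aestronglyMeasurable
  refine ⟨integral_nonneg_of_ae hw0, ?_, ?_⟩
  · rw [hk]
    refine ENNReal.toReal_mono (by finiteness) ?_
    have := weightedMoment_one_le hw0 (q := fun _ => 1) measurable_const hη
    rw [weightedMoment_one, weightedMoment_zero, weightedMoment] at this
    simp only [mul_one, lintegral_const, measure_univ] at this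
    exact this.trans (by gcongr)
  · rw [hk, weightedMoment_zero, weightedMoment_one, hwb, ENNReal.toReal_mul]

/-- The regression functions of `Y` on `X + Y` and on `X` agree asymptotically. -/
lemma IsMonotoneCondDensity.eventually_regression (hf : IsMonotoneCondDensity P X Y f)
    (hX : Measurable X) (hY : Measurable Y) (hY0 : ∀ ω, 0 ≤ Y ω) {κ : ℝ}
    (hκ : IsUniformlyRegVarying f κ) {η : ℝ} (hη : 1 < η) (hmX : supCondMoment P Y X η ≠ ⊤)
    (hmZ : supCondMoment P Y (X + Y) η ≠ ⊤) {ε : ℝ} (hε : 0 < ε) :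
    ∃ z₀, ∀ᵐ z ∂(P.map (X + Y)), z₀ ≤ z →
      |momentFun P Y f 1 z / momentFun P Y f 0 z - ∫ y, y ∂(condDistrib Y (X + Y) P z)| ≤ ε := by
  set K : ℝ := (1 + 2 * supCondMoment P Y X η).toReal with hKdef
  have hK : 0 ≤ K := ENNReal.toReal_nonneg
  have hK2 : 0 < 20 * K + 5 := by positivity
  set δ : ℝ := min (1 / 2) (ε / (20 * K + 5)) with hδdef
  have hδ : 0 < δ := lt_min (by norm_num) (by positivity)
  have hδ1 : δ ≤ 1 / 2 := min_le_left _ _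
  have hδε : δ * (20 * K + 5) ≤ ε := (le_div_iff₀ hK2).1 (min_le_right _ _)
  have hZ := hX.add hY
  have hq := (hf.isJointDensity hX hY hY0).add
  obtain ⟨z₀, hz₀⟩ := eventually_atTop.1
    (((hf.eventually_shift hX hY hY0 hκ (show (0 : ℝ) < η by linarith) hmX hmZ hδ).and
      (hf.eventually_shift hX hY hY0 hκ hη hmX hmZ hδ)).and
      ((hf.eventually_weightedMoment_one_le hX hY hY0 hκ hη.le).and (eventually_gt_atTop 0)))
  refine ⟨z₀, ?_⟩
  filter_upwards [hq.regression hZ hY hY0 hη.le hmZ,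
    (hq.ae_map_iff hZ).2 (hq.marginal_lt_top.mono fun w hw _ => hw),
    (hq.ae_map_iff hZ).2 ((hq.moment_le hZ hY (η := η)).mono fun w hw _ => hw)]
    with z hreg hfinZ hmom hzz
  obtain ⟨⟨h0, h1⟩, hm, hz0⟩ := hz₀ z hzz
  rw [← weightedMoment_zero _ (fun y => extendedDensity f (z - y) y)] at hfinZ hmom
  have hfin0 := (hf.weightedMoment_zero_lt_top hX hY hY0 hz0).ne
  have hfin1 : weightedMoment (P.map Y) (extendedDensity f z) 1 ≠ ⊤ :=
    ne_top_of_le_ne_top (ENNReal.mul_ne_top (by finiteness) hfin0) hm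
  have hc1 := h0.2 hmom
  have hk1 := h1.2 hmom
  have hfinZ1 : weightedMoment (P.map Y) (fun y => extendedDensity f (z - y) y) 1 ≠ ⊤ :=
    ne_top_of_le_ne_top (by finiteness) hk1
  have hbK : momentFun P Y f 1 z ≤ K * momentFun P Y f 0 z := by
    have := ENNReal.toReal_mono (ENNReal.mul_ne_top (by finiteness) hfin0) hm
    rwa [ENNReal.toReal_mul] at this
  have r1 := toReal_le_mul_add (show 0 ≤ 1 + δ by linarith) hδ.le hfin0 hfinZ.ne hc1
  have r2 := toReal_le_mul_add (A := weightedMoment (P.map Y) (extendedDensity f z) 0)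
    (r := 1) zero_le_one hδ.le hfinZ.ne hfin0
    (by rw [ENNReal.ofReal_one, one_mul]; exact h0.1)
  have r3 := toReal_le_mul_add (show 0 ≤ 1 + δ by linarith) hδ.le hfin1 hfinZ.ne hk1
  have r4 := toReal_le_mul_add (A := weightedMoment (P.map Y) (extendedDensity f z) 1)
    (r := 1) zero_le_one hδ.le hfinZ1 hfin0
    (by rw [ENNReal.ofReal_one, one_mul]; exact h1.1)
  rw [one_mul] at r2 r4
  rw [← hreg.2.2] at r3 r4
  exact (regression_estimate hδ hδ1 hK (hf.momentFun_zero_pos hX hY hY0 hz0)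
    (momentFun_nonneg 1 z) hbK r1 r2 r3 r4 hreg.1).trans hδε

end

/-! ### Asymptotic equality of the three sensitivities -/

section
variable {Ω : Type*} [MeasurableSpace Ω] {P : Measure Ω} [IsProbabilityMeasure P]

lemma ae_VaR {W : Ω → ℝ} (hW : Measurable W) {p : ℝ → Prop} (h : ∀ᵐ w ∂(P.map W), p w) :
    ∀ᵐ u ∂(volume.restrict (Ioo (0 : ℝ) 1)), p (VaR P W u) := by
  rw [← map_VaR hW] at h
  exact ae_of_ae_map (aemeasurable_VaR W) h

lemma integrable_VaR_mul {W : Ω → ℝ} (hW : Measurable W) (hint : Integrable W P) {φ : ℝ → ℝ}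
    (hφ : IsAdmissibleSpectrum φ) {L : ℝ} (hL : Tendsto φ (𝓝[<] 1) (𝓝 L)) :
    IntegrableOn (fun u => VaR P W u * φ u) (Ioo 0 1) := by
  refine (integrableOn_VaR hW hint).mul_bdd (c := L) hφ.integrableOn.aestronglyMeasurable ?_
  filter_upwards [ae_restrict_mem measurableSet_Ioo] with u hu
  have hu' : u ∈ Ico (0 : ℝ) 1 := ⟨hu.1.le, hu.2⟩
  rw [Real.norm_of_nonneg (hφ.nonneg u hu')]
  exact hφ.le_of_tendsto hL hu'

lemma integrable_bounded_mul {k : ℝ → ℝ} {K : ℝ}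
    (hk : AEStronglyMeasurable k (volume.restrict (Ioo (0 : ℝ) 1)))
    (hK : ∀ᵐ u ∂(volume.restrict (Ioo (0 : ℝ) 1)), |k u| ≤ K) {φ : ℝ → ℝ}
    (hφ : IsAdmissibleSpectrum φ) : IntegrableOn (fun u => k u * φ u) (Ioo 0 1) :=
  hφ.integrableOn.bdd_mul hk hK

/-- Two quantities with vanishing difference, one of them bounded away from zero. -/
lemma tendsto_div_one_of_tendsto_sub {ι : Type*} {l : Filter ι} {A B : ι → ℝ} {c : ℝ}
    (hc : 0 < c) (hB : ∀ᶠ i in l, c ≤ B i) (h : Tendsto (fun i => A i - B i) l (𝓝 0)) :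
    Tendsto (fun i => A i / B i) l (𝓝 1) := by
  have h1 : Tendsto (fun i => |A i - B i| / c) l (𝓝 0) := by
    simpa using h.abs.div_const c
  rw [tendsto_iff_norm_sub_tendsto_zero]
  refine squeeze_zero' (Eventually.of_forall fun i => norm_nonneg _) ?_ h1
  filter_upwards [hB] with i hi
  have hBi : 0 < B i := hc.trans_le hi
  rw [show A i / B i - 1 = (A i - B i) / B i by field_simp, Real.norm_eq_abs, abs_div,
    abs_of_pos hBi]
  gcongr

end

theorem theorem3 {Ω : Type*} [MeasurableSpace Ω] (P : Measure Ω) [IsProbabilityMeasure P]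
    (X Y : Ω → ℝ) (hX : Measurable X) (hY : Measurable Y)
    (hX0 : ∀ ω, 0 ≤ X ω) (hY0 : ∀ ω, 0 ≤ Y ω)
    -- the distribution functions are continuous
    (hFX : Continuous fun x => cdf (P.map X) x)
    (hFY : Continuous fun y => cdf (P.map Y) y)
    (hFZ : Continuous fun z => cdf (P.map (X + Y)) z)
    -- the tails are regularly varying
    (β γ : ℝ) (hβ : 1 < β)
    (hXtail : IsRegVarying (tailFun P X) (-β)) (hYtail : IsRegVarying (tailFun P Y) (-γ))
    -- the confidence-level-based family of bounded spectra
    (φ : ℝ → ℝ → ℝ) (hφ : IsCLBSpectrum φ)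
    (hφ_bdd : ∀ α ∈ Ioo (0 : ℝ) 1, ∃ L : ℝ, Tendsto (φ α) (𝓝[<] 1) (𝓝 L))
    -- the conditional density of `X` given `Y`, uniformly regularly varying
    (f : ℝ → ℝ → ℝ) (hf : IsMonotoneCondDensity P X Y f)
    (κ : ℝ) (hκ : IsUniformlyRegVarying f κ)
    -- the density of `X + Y` is regularly varying
    (fZ : ℝ → ℝ) (hfZ : IsDensityOf P (X + Y) fZ) (hfZ_reg : ∃ k : ℝ, IsRegVarying fZ k)
    -- bounded conditional moments of `Y`
    (hmom : ∃ η : ℝ, max (-κ - β) 1 < η ∧ supCondMoment P Y X η + supCondMoment P Y (X + Y) η < ⊤)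
    -- the lower limit of `E^{Q^X_α}[Y]` is positive
    (hliminf : (0 : EReal) <
      liminf (fun α => ((∫ ω, Y ω ∂(spectralMeasure P (φ α) X) : ℝ) : EReal)) (𝓝[<] (1 : ℝ)))
    (hβγ : β + 1 < γ) :
    Tendsto (fun α => (∫ ω, Y ω ∂(spectralMeasure P (φ α) X)) /
        (spectralRisk P (φ α) (X + Y) - spectralRisk P (φ α) X)) (𝓝[<] 1) (𝓝 1) ∧
      Tendsto (fun α => (spectralRisk P (φ α) (X + Y) - spectralRisk P (φ α) X) /
        (∫ ω, Y ω ∂(spectralMeasure P (φ α) (X + Y)))) (𝓝[<] 1) (𝓝 1) := by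
  obtain ⟨η, hηmax, hmsum⟩ := hmom
  have hη : 1 < η := (le_max_right _ _).trans_lt hηmax
  obtain ⟨hmX', hmZ'⟩ := ENNReal.add_lt_top.1 hmsum
  have hmX := hmX'.ne
  have hmZ := hmZ'.ne
  have hZ : Measurable (X + Y) := hX.add hY
  have hXZ : ∀ ω, X ω ≤ (X + Y) ω := fun ω => by simpa using hY0 ω
  have hYint : Integrable Y P :=
    integrable_of_isRegVarying_tailFun hY hY0 (by linarith) hYtail
  have hXint : Integrable X P := integrable_of_isRegVarying_tailFun hX hX0 hβ hXtail
  have hZint : Integrable (X + Y) P := hXint.add hYint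
  have htX := tailFun_pos hXtail
  have hFX1 : ∀ x, cdf (P.map X) x < 1 := fun x => by
    have := htX x
    rw [tailFun_eq_one_sub hX] at this
    linarith
  have hFZ1 : ∀ z, cdf (P.map (X + Y)) z < 1 := fun z => by
    have h1 : tailFun P X z ≤ tailFun P (X + Y) z :=
      measureReal_mono fun ω hω => lt_of_lt_of_le hω (hXZ ω)
    have := (htX z).trans_le h1
    rw [tailFun_eq_one_sub hZ] at this
    linarith
  set μ : Measure ℝ := volume.restrict (Ioo (0 : ℝ) 1) with hμ
  set x : ℝ → ℝ := VaR P X with hx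
  set z : ℝ → ℝ := VaR P (X + Y) with hz
  set kX : ℝ → ℝ := fun u => ∫ y, y ∂(condDistrib Y X P (x u)) with hkX
  set kZ : ℝ → ℝ := fun u => ∫ y, y ∂(condDistrib Y (X + Y) P (z u)) with hkZ
  set g : ℝ → ℝ := fun w => momentFun P Y f 1 w / momentFun P Y f 0 w with hg
  have hregX := ae_VaR hX ((hf.isJointDensity hX hY hY0).regression hX hY hY0 hη.le hmX)
  have hregZ := ae_VaR hZ ((hf.isJointDensity hX hY hY0).add.regression hZ hY hY0 hη.le hmZ)
  set KX : ℝ := (1 + supCondMoment P Y X η).toReal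
  set KZ : ℝ := (1 + supCondMoment P Y (X + Y) η).toReal
  have hkXb : ∀ᵐ u ∂μ, |kX u| ≤ KX := by
    filter_upwards [hregX] with u hu
    rw [abs_of_nonneg hu.1]
    exact hu.2.1
  have hkZb : ∀ᵐ u ∂μ, |kZ u| ≤ KZ := by
    filter_upwards [hregZ] with u hu
    rw [abs_of_nonneg hu.1]
    exact hu.2.1
  have hk : ∀ W : Ω → ℝ, AEStronglyMeasurable
      (fun u => ∫ y, y ∂(condDistrib Y W P (VaR P W u))) μ := fun W =>
    ((measurable_snd.stronglyMeasurable
      (f := fun p : ℝ × ℝ => p.2)).integral_condDistrib.measurable.comp_aemeasurable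
        (aemeasurable_VaR W)).aestronglyMeasurable
  have htopX : Tendsto x (𝓝[<] 1) atTop := tendsto_VaR_atTop hFX1
  have htopZ : Tendsto z (𝓝[<] 1) atTop := tendsto_VaR_atTop hFZ1
  have hxz : ∀ u ∈ Ioo (0 : ℝ) 1, x u ≤ z u := fun u hu => VaR_le_VaR hX hZ hXZ hu
  have hIoo : Ioo (0 : ℝ) 1 ∈ 𝓝[<] (1 : ℝ) := Ioo_mem_nhdsLT one_pos
  -- the gap of the quantiles at a common level close to one
  have hgap : ∀ ε : ℝ, 0 < ε → ∀ᶠ u in 𝓝[<] (1 : ℝ),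
      |g (x u) - (z u - x u)| ≤ ε ∧ |g (x u) - g (z u)| ≤ ε := by
    intro ε hε
    filter_upwards [htopZ.eventually (hf.eventually_gap hX hY hY0 hκ hη hmX (by linarith) hβγ
      hXtail hYtail hε), htopX.eventually_gt_atTop 0, hIoo] with u hu hx0 hu01
    refine hu (x u) hx0 (hxz u hu01) ?_
    rw [tailFun_eq_one_sub hX, tailFun_eq_one_sub hZ, cdf_VaR hFX hu01, cdf_VaR hFZ hu01]
  have hkXg : ∀ᵐ u ∂μ, 0 < x u → kX u = g (x u) := by
    filter_upwards [hregX] with u hu hx0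
    rw [hg, eq_div_iff (hf.momentFun_zero_pos hX hY hY0 hx0).ne']
    exact hu.2.2
  have hthr : ∀ {p : ℝ → Prop}, (∀ᶠ u in 𝓝[<] (1 : ℝ), p u) →
      ∃ u₀ < (1 : ℝ), 0 < u₀ ∧ ∀ u ∈ Ioo u₀ 1, p u := by
    intro p hp
    obtain ⟨l, hl, hlp⟩ := (mem_nhdsLT_iff_exists_Ioo_subset).1 hp
    refine ⟨max l (1 / 2), max_lt hl (by norm_num), lt_max_of_lt_right (by norm_num),
      fun u hu => hlp ⟨(le_max_left _ _).trans_lt hu.1, hu.2⟩⟩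
  have hgapX : ∀ ε : ℝ, 0 < ε → ∃ u₀ < (1 : ℝ), 0 < u₀ ∧ ∀ᵐ u ∂μ, u₀ < u →
      |kX u - (z u - x u)| ≤ ε := by
    intro ε hε
    obtain ⟨u₀, hu₀, hpos, h⟩ := hthr ((hgap ε hε).and (htopX.eventually_gt_atTop 0))
    refine ⟨u₀, hu₀, hpos, ?_⟩
    filter_upwards [hkXg, ae_restrict_mem measurableSet_Ioo] with u hu hu01 hlt
    obtain ⟨h1, h2⟩ := h u ⟨hlt, hu01.2⟩
    rw [hu h2]
    exact h1.1
  have hgapZ : ∀ ε : ℝ, 0 < ε → ∃ u₀ < (1 : ℝ), ∀ᵐ u ∂μ, u₀ < u →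
      |(z u - x u) - kZ u| ≤ ε := by
    intro ε hε
    obtain ⟨z₀, hz₀⟩ := hf.eventually_regression hX hY hY0 hκ hη hmX hmZ
      (show 0 < ε / 3 by linarith)
    obtain ⟨u₀, hu₀, -, h⟩ := hthr ((hgap (ε / 3) (by linarith)).and
      (htopZ.eventually_ge_atTop z₀))
    refine ⟨u₀, hu₀, ?_⟩
    filter_upwards [ae_VaR hZ hz₀, ae_restrict_mem measurableSet_Ioo] with u hu hu01 hlt
    obtain ⟨⟨h1, h2⟩, h3⟩ := h u ⟨hlt, hu01.2⟩
    have h4 : |g (z u) - kZ u| ≤ ε / 3 := hu h3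
    rw [abs_le] at h1 h2 h4 ⊢
    constructor <;> linarith [h1.1, h1.2, h2.1, h2.2, h4.1, h4.2]
  -- the quantile gap is bounded on the whole unit interval
  obtain ⟨M, hM⟩ : ∃ M, ∀ᵐ u ∂μ, |z u - x u| ≤ M := by
    obtain ⟨u₀, hu₀, hpos, h⟩ := hgapX 1 one_pos
    refine ⟨max (KX + 1) (z u₀), ?_⟩
    filter_upwards [h, hkXb, ae_restrict_mem measurableSet_Ioo] with u hu hkb hu01
    rw [abs_of_nonneg (by linarith [hxz u hu01])]
    rcases lt_or_ge u₀ u with hlt | hge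
    · refine le_max_of_le_left ?_
      linarith [(abs_le.1 (hu hlt)).1, (abs_le.1 hkb).2]
    · refine le_max_of_le_right ?_
      have h1 : z u ≤ z u₀ := monotoneOn_VaR (X + Y) hu01 ⟨hpos, hu₀⟩ hge
      have h2 : 0 ≤ x u := VaR_nonneg hX hX0 hu01
      linarith
  have hlimX := hφ.tendsto_integral_mul (h := fun u => kX u - (z u - x u)) (K := KX + M)
    (by
      filter_upwards [hkXb, hM] with u h1 h2
      exact (abs_sub _ _).trans (add_le_add h1 h2))
    fun ε hε => (hgapX ε hε).imp fun u h => ⟨h.1, h.2.2⟩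
  have hlimZ := hφ.tendsto_integral_mul (h := fun u => (z u - x u) - kZ u) (K := M + KZ)
    (by
      filter_upwards [hkZb, hM] with u h1 h2
      exact (abs_sub _ _).trans (add_le_add h2 h1))
    hgapZ
  have hdiffX : Tendsto (fun α => (∫ ω, Y ω ∂(spectralMeasure P (φ α) X)) -
      (spectralRisk P (φ α) (X + Y) - spectralRisk P (φ α) X)) (𝓝[<] 1) (𝓝 0) := by
    refine hlimX.congr' ?_
    filter_upwards [hIoo] with α hα
    have hadm := hφ.admissible α hα
    obtain ⟨L, hL⟩ := hφ_bdd α hα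
    have iX := integrable_VaR_mul hX hXint hadm hL
    have iZ := integrable_VaR_mul hZ hZint hadm hL
    have iD : IntegrableOn (fun u => VaR P (X + Y) u * φ α u - VaR P X u * φ α u) (Ioo 0 1) :=
      iZ.sub iX
    rw [integral_spectralMeasure hYint hY hX hFX hFX1 hadm hL, spectralRisk, spectralRisk,
      ← integral_sub iZ iX, ← integral_sub (integrable_bounded_mul (hk X) hkXb hadm) iD]
    refine integral_congr_ae (ae_of_all _ fun u => ?_)
    simp only [hkX, hx, hz]
    ring
  have hdiffZ : Tendsto (fun α => (spectralRisk P (φ α) (X + Y) - spectralRisk P (φ α) X) -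
      ∫ ω, Y ω ∂(spectralMeasure P (φ α) (X + Y))) (𝓝[<] 1) (𝓝 0) := by
    refine hlimZ.congr' ?_
    filter_upwards [hIoo] with α hα
    have hadm := hφ.admissible α hα
    obtain ⟨L, hL⟩ := hφ_bdd α hα
    have iX := integrable_VaR_mul hX hXint hadm hL
    have iZ := integrable_VaR_mul hZ hZint hadm hL
    have iD : IntegrableOn (fun u => VaR P (X + Y) u * φ α u - VaR P X u * φ α u) (Ioo 0 1) :=
      iZ.sub iX
    rw [integral_spectralMeasure hYint hY hZ hFZ hFZ1 hadm hL, spectralRisk, spectralRisk,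
      ← integral_sub iZ iX, ← integral_sub iD
      (integrable_bounded_mul (hk (X + Y)) hkZb hadm)]
    refine integral_congr_ae (ae_of_all _ fun u => ?_)
    simp only [hkZ, hx, hz]
    ring
  -- all three quantities are bounded away from zero
  obtain ⟨c, hc0, hc⟩ := EReal.lt_iff_exists_real_btwn.1 hliminf
  have hc0 : 0 < c := by exact_mod_cast hc0
  have hA : ∀ᶠ α in 𝓝[<] (1 : ℝ), c < ∫ ω, Y ω ∂(spectralMeasure P (φ α) X) :=
    (eventually_lt_of_lt_liminf hc).mono fun α hα => by exact_mod_cast hα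
  have hB : ∀ᶠ α in 𝓝[<] (1 : ℝ),
      c / 2 < spectralRisk P (φ α) (X + Y) - spectralRisk P (φ α) X := by
    filter_upwards [hA, hdiffX.eventually_lt_const (show 0 < c / 2 by linarith)] with α h1 h2
    linarith
  have hC : ∀ᶠ α in 𝓝[<] (1 : ℝ), c / 4 < ∫ ω, Y ω ∂(spectralMeasure P (φ α) (X + Y)) := by
    filter_upwards [hB, hdiffZ.eventually_lt_const (show 0 < c / 4 by linarith)] with α h1 h2
    linarith
  exact ⟨tendsto_div_one_of_tendsto_sub (by linarith) (hB.mono fun _ h => h.le) hdiffX,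
    tendsto_div_one_of_tendsto_sub (by linarith) (hC.mono fun _ h => h.le) hdiffZ⟩
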